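/- Let $\mathcal H$ be a separable complex Hilbert space with an orthogonal decomposition $\mathcal H=\mathcal H_+\oplus\mathcal H_-$ into infinite-dimensional closed subspaces, let $P_+$ be the orthogonal projector onto $\mathcal H_+$, and write $L^2(E,F)$ for the Hilbert--Schmidt operators $E\to F$ with the Hilbert--Schmidt norm. For a closed subspace $W$ let $P_W$ be the orthogonal projector onto it; closed subspaces are identified with their projectors. The restricted Grassmannian $\mathrm{Gr}_{\rm res}$ is the set of closed subspaces $W\subset\mathcal H$ for which the orthogonal projection $W\to\mathcal H_+$ is Fredholm and the orthogonal projection $W\to\mathcal H_-$ is Hilbert--Schmidt. Its charts are, for $W\in\mathrm{Gr}_{\rm res}$, $$\phi_W(V)=P_{W^\perp}(P_W|_V)^{-1}\in L^2(W,W^\perp),\qquad V\in\mathrm{Gr}_{\rm res},\quad V\oplus W^\perp=\mathcal H .$$ Let $U_{\rm res}$ be the group of unitary operators $g$ on $\mathcal H$ with $[g,P_+]\in L^2(\mathcal H,\mathcal H)$, a submanifold of the algebra of bounded operators $X$ with $[X,P_+]\in L^2(\mathcal H,\mathcal H)$, normed by $\max(\|X\|,\|[X,P_+]\|_2)$. Let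 $U_+$ be the unitary group of $\mathcal H_+$ with the operator norm and $\mathfrak u_+$ the real Banach space of skew-adjoint bounded operators on $\mathcal H_+$. Let $\mathfrak U_{\rm res}$ be the groupoid over $\mathrm{Gr}_{\rm res}$ of all partial isometries $u$ of $\mathcal H$ with $u^*u,\,uu^*\in\mathrm{Gr}_{\rm res}$, with source $s(u)=u^*u$ and target $t(u)=uu^*$. Its charts are $$\Phi_{\alpha\beta\gamma}(u)=\bigl(\phi_{W_\gamma}(uu^*),\ \phi_{W_\beta}(u^*u),\ \psi_\alpha(\sigma_\gamma(uu^*)^{-1}\,u\,\sigma_\beta(u^*u)|_{\mathcal H_+})\bigr)\in L^2(W_\gamma,W_\gamma^\perp)\times L^2(W_\beta,W_\beta^\perp)\times\mathfrak u_+,$$ where $\psi_\alpha:V_\alpha\to\mathfrak u_+$ is a smooth chart of $U_+$, and $\sigma_\beta:\Omega_\beta\to U_{\rm res}$, $\sigma_\gamma:\Omega_\gamma\to U_{\rm res}$ are smooth maps with $\sigma(V)\mathcal H_+=V$ on open sets $\Omega_\beta\ni W_\beta$, $\Omega_\gamma\ni W_\gamma$ contained in the domains of $\phi_{W_\beta}$,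 $\phi_{W_\gamma}$; the domain of $\Phi_{\alpha\beta\gamma}$ is the set of $u\in\mathfrak U_{\rm res}$ with $u^*u\in\Omega_\beta$, $uu^*\in\Omega_\gamma$ and $\sigma_\gamma(uu^*)^{-1}u\,\sigma_\beta(u^*u)|_{\mathcal H_+}\in V_\alpha$. Then the groupoid $\mathfrak U_{\rm res}$ is transitive and pure: 1. (Transitive) The map $(s,t):\mathfrak U_{\rm res}\to\mathrm{Gr}_{\rm res}\times\mathrm{Gr}_{\rm res}$ is surjective. 2. (Pure base) The maps $\phi_W$ are well defined, i.e. take Hilbert--Schmidt values, and form a smooth atlas making $\mathrm{Gr}_{\rm res}$ a smooth Hausdorff Banach manifold; for every $W\in\mathrm{Gr}_{\rm res}$ the model space $L^2(W,W^\perp)$ is isomorphic, as a complex Banach space, to $L^2(\mathcal H_+,\mathcal H_-)$. 3. (Pure total space) The maps $\Phi_{\alpha\beta\gamma}$, over all choices of $\psi_\alpha,\sigma_\beta,\sigma_\gamma$ as above, form a smooth atlas making $\mathfrak U_{\rm res}$ a smooth Hausdorff Banach manifold; each of the model spaces $L^2(W_\gamma,W_\gamma^\perp)\times L^2(W_\beta,W_\beta^\perp)\times\mathfrak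 u_+$ is isomorphic, as a real Banach space, to $L^2(\mathcal H_+,\mathcal H_-)\times L^2(\mathcal H_+,\mathcal H_-)\times\mathfrak u_+$. -/

import Mathlib

open scoped ENNReal ContDiff

noncomputable section

/-! ### Hilbert-Schmidt operators -/

section HilbertSchmidt

variable (E F : Type*) [NormedAddCommGroup E] [InnerProductSpace ℂ E] [CompleteSpace E]
  [NormedAddCommGroup F] [InnerProductSpace ℂ F] [CompleteSpace F]

/-- The index set of a fixed Hilbert basis of `E`. -/
def hsIndex : Set E := (exists_hilbertBasis ℂ E).choose

/-- A fixed Hilbert basis of `E`. -/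
def hsBasis : HilbertBasis (hsIndex E) ℂ E := (exists_hilbertBasis ℂ E).choose_spec.choose

variable {E F}

/-- `T` is Hilbert-Schmidt: `∑ ‖T eᵢ‖² < ∞` for an orthonormal basis `(eᵢ)`. The condition and the
value of the sum do not depend on the basis, see `tsum_enorm_sq_hilbertBasis`. -/
def IsHilbertSchmidt (T : E →L[ℂ] F) : Prop :=
  Summable fun i : hsIndex E => ‖T (hsBasis E i)‖ ^ 2

/-- Parseval's identity. -/
theorem tsum_enorm_inner_sq {ι : Type*} (b : HilbertBasis ι ℂ E) (x : E) :
    ∑' i, ‖inner ℂ (b i) x‖ₑ ^ 2 = ‖x‖ₑ ^ 2 := by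
  have h := b.hasSum_inner_mul_inner x x
  have h2 : HasSum (fun i => ‖inner ℂ (b i) x‖ ^ 2) (‖x‖ ^ 2) := by
    have h3 := Complex.hasSum_re h
    convert h3 using 1
    · ext i
      rw [← inner_conj_symm x (b i), ← Complex.normSq_eq_conj_mul_self, Complex.ofReal_re,
        Complex.normSq_eq_norm_sq]
    · rw [inner_self_eq_norm_sq_to_K]
      norm_cast
  have h4 := ENNReal.ofReal_tsum_of_nonneg (fun i => sq_nonneg ‖inner ℂ (b i) x‖) h2.summable
  rw [h2.tsum_eq] at h4
  simpa [ENNReal.ofReal_pow, ofReal_norm] using h4.symm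

theorem tsum_enorm_sq_adjoint {ι κ : Type*} (T : E →L[ℂ] F) (b : HilbertBasis ι ℂ E)
    (c : HilbertBasis κ ℂ F) :
    ∑' i, ‖T (b i)‖ₑ ^ 2 = ∑' j, ‖ContinuousLinearMap.adjoint T (c j)‖ₑ ^ 2 := by
  calc ∑' i, ‖T (b i)‖ₑ ^ 2 = ∑' i, ∑' j, ‖inner ℂ (c j) (T (b i))‖ₑ ^ 2 := by
        simp_rw [tsum_enorm_inner_sq c]
    _ = ∑' j, ∑' i, ‖inner ℂ (c j) (T (b i))‖ₑ ^ 2 := ENNReal.tsum_comm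
    _ = ∑' j, ∑' i, ‖inner ℂ (b i) (ContinuousLinearMap.adjoint T (c j))‖ₑ ^ 2 := by
        congr with j; congr with i
        rw [← ContinuousLinearMap.adjoint_inner_left, ← ofReal_norm, ← ofReal_norm, norm_inner_symm]
    _ = _ := by simp_rw [tsum_enorm_inner_sq b]

/-- The Hilbert-Schmidt sum does not depend on the orthonormal basis. -/
theorem tsum_enorm_sq_hilbertBasis {ι ι' : Type*} (T : E →L[ℂ] F) (b : HilbertBasis ι ℂ E)
    (b' : HilbertBasis ι' ℂ E) : ∑' i, ‖T (b i)‖ₑ ^ 2 = ∑' i, ‖T (b' i)‖ₑ ^ 2 := by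
  rw [tsum_enorm_sq_adjoint T b (hsBasis F), tsum_enorm_sq_adjoint T b' (hsBasis F)]

theorem isHilbertSchmidt_iff_memℓp (T : E →L[ℂ] F) :
    IsHilbertSchmidt T ↔ Memℓp (fun i : hsIndex E => T (hsBasis E i)) 2 := by
  rw [memℓp_gen_iff (by norm_num)]
  simp [IsHilbertSchmidt]

variable (E F)

/-- The Hilbert-Schmidt operators as a linear subspace of the bounded operators. -/
def hsSubmodule : Submodule ℂ (E →L[ℂ] F) where
  carrier := {T | IsHilbertSchmidt T}
  zero_mem' := by simp [IsHilbertSchmidt, summable_zero]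
  add_mem' := by
    intro S T hS hT
    simp only [Set.mem_ofPred_eq, isHilbertSchmidt_iff_memℓp] at *
    exact hS.add hT
  smul_mem' := by
    intro c T hT
    simp only [Set.mem_ofPred_eq, isHilbertSchmidt_iff_memℓp] at *
    exact hT.const_smul c

/-- The space `L²(E, F)` of Hilbert-Schmidt operators `E → F`, normed below by the
Hilbert-Schmidt norm. -/
def HilbertSchmidt : Type _ := hsSubmodule E F

instance : AddCommGroup (HilbertSchmidt E F) := inferInstanceAs (AddCommGroup (hsSubmodule E F))

instance : Module ℂ (HilbertSchmidt E F) := inferInstanceAs (Module ℂ (hsSubmodule E F))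

/-- The inclusion of the Hilbert-Schmidt operators into the bounded operators. -/
def HilbertSchmidt.toCLM : HilbertSchmidt E F →ₗ[ℂ] (E →L[ℂ] F) := (hsSubmodule E F).subtype

/-- The values `(T eᵢ)ᵢ` on the basis, as a square-summable family. -/
def HilbertSchmidt.coord : HilbertSchmidt E F →ₗ[ℂ] lp (fun _ : hsIndex E => F) 2 where
  toFun T := ⟨fun i => HilbertSchmidt.toCLM E F T (hsBasis E i),
    (isHilbertSchmidt_iff_memℓp _).1 T.2⟩
  map_add' _ _ := rfl
  map_smul' _ _ := rfl

theorem HilbertSchmidt.coord_injective : Function.Injective (HilbertSchmidt.coord E F) := by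
  intro S T h
  apply Subtype.ext
  have h1 : ∀ i, HilbertSchmidt.toCLM E F S (hsBasis E i) =
      HilbertSchmidt.toCLM E F T (hsBasis E i) := fun i =>
    congrFun (congrArg (fun x : lp (fun _ : hsIndex E => F) 2 => (x : hsIndex E → F)) h) i
  refine ContinuousLinearMap.ext_on (s := Set.range (hsBasis E)) ?_ ?_
  · exact Submodule.dense_iff_topologicalClosure_eq_top.2 (hsBasis E).dense_span
  · rintro _ ⟨i, rfl⟩
    exact h1 i

/-- The Hilbert-Schmidt norm `‖T‖₂ = (∑ ‖T eᵢ‖²)^(1/2)`, see `HilbertSchmidt.norm_sq_eq`. -/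
instance : NormedAddCommGroup (HilbertSchmidt E F) :=
  NormedAddCommGroup.induced _ _ (HilbertSchmidt.coord E F) (HilbertSchmidt.coord_injective E F)

instance : NormedSpace ℂ (HilbertSchmidt E F) :=
  NormedSpace.induced ℂ _ _ (HilbertSchmidt.coord E F)

variable {E F}

theorem HilbertSchmidt.norm_sq_eq (T : HilbertSchmidt E F) :
    ‖T‖ ^ 2 = ∑' i, ‖HilbertSchmidt.toCLM E F T (hsBasis E i)‖ ^ 2 := by
  have h := lp.norm_rpow_eq_tsum (p := 2) (by norm_num) (HilbertSchmidt.coord E F T)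
  simp only [ENNReal.toReal_ofNat, Real.rpow_ofNat] at h
  exact h

open Classical in
/-- A bounded operator as an element of `L²(E, F)`; the value is `0` if the operator is not
Hilbert-Schmidt. -/
def HilbertSchmidt.ofCLM (T : E →L[ℂ] F) : HilbertSchmidt E F :=
  if h : IsHilbertSchmidt T then ⟨T, h⟩ else 0

end HilbertSchmidt

/-! ### Banach manifolds with possibly varying model spaces -/

section Atlas

variable {M ι : Type*} {E : ι → Type*} [∀ i, NormedAddCommGroup (E i)] [∀ i, NormedSpace ℝ (E i)]

/-- The topology on `M` generated by charts `φ i : src i → E i`. -/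
@[reducible] def atlasTopology (src : ι → Set M) (φ : ∀ i, M → E i) : TopologicalSpace M :=
  TopologicalSpace.generateFrom {U | ∃ i, ∃ s : Set (E i), IsOpen s ∧ U = src i ∩ φ i ⁻¹' s}

/-- The charts `φ i`, defined on `src i ⊆ M` and with values in `E i`, form a smooth atlas which
makes `M` a smooth Hausdorff Banach manifold; the model space may depend on the chart. -/
structure IsBanachManifoldAtlas (src : ι → Set M) (φ : ∀ i, M → E i) : Prop where
  complete : ∀ i, CompleteSpace (E i)
  cover : ∀ x, ∃ i, x ∈ src i
  injOn : ∀ i, Set.InjOn (φ i) (src i)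
  isOpen_image : ∀ i j, IsOpen (φ i '' (src i ∩ src j))
  /-- the transition map `φ j ∘ (φ i)⁻¹` is smooth on `φ i (src i ∩ src j)` -/
  smooth_transition : ∀ i j, ∃ g : E i → E j,
    ContDiffOn ℝ ∞ g (φ i '' (src i ∩ src j)) ∧ ∀ x ∈ src i ∩ src j, g (φ i x) = φ j x
  hausdorff : @T2Space M (atlasTopology src φ)

end Atlas

/-! ### The restricted Grassmannian -/

section Grassmannian

variable {H : Type*} [NormedAddCommGroup H] [InnerProductSpace ℂ H] [CompleteSpace H]

/-- The condition for a closed subspace `W` to be in the restricted Grassmannian: the orthogonal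
projection `W → H₊` is Fredholm and the orthogonal projection `W → H₋` is Hilbert-Schmidt. Here
`H₋` is the orthogonal complement of `H₊ = Hp`. -/
def IsRestricted (Hp W : Submodule ℂ H) [CompleteSpace Hp] [CompleteSpace W] : Prop :=
  ContinuousLinearMap.IsFredholm (Hp.orthogonalProjectionOnto ∘L W.subtypeL) ∧
    IsHilbertSchmidt (Hpᗮ.orthogonalProjectionOnto ∘L W.subtypeL)

variable (Hp : Submodule ℂ H) [CompleteSpace Hp]

/-- The restricted Grassmannian; a closed subspace is identified with the orthogonal projector
onto it. -/
def ResGr : Set (H →L[ℂ] H) :=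
  {p | ∃ (W : Submodule ℂ H) (_ : CompleteSpace W), IsRestricted Hp W ∧ W.starProjection = p}

variable {Hp}

/-- The closed subspace belonging to a point of the restricted Grassmannian. -/
def ResGr.space (p : ResGr Hp) : Submodule ℂ H := LinearMap.range (p : H →L[ℂ] H).toLinearMap

instance (p : ResGr Hp) : CompleteSpace (ResGr.space p) := by
  obtain ⟨W, hW, -, h⟩ := p.2
  have : ResGr.space p = W := by
    rw [ResGr.space, ← h]
    exact W.range_starProjection
  rw [this]
  exact hW

/-- The domain of the chart centred at `W`: all `V` in the restricted Grassmannian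
with `V ⊕ W^⊥ = H`. -/
def ResGr.chartDomain (W : ResGr Hp) : Set (ResGr Hp) :=
  {V | IsCompl (ResGr.space V) (ResGr.space W)ᗮ}

/-- The bounded operator `P_{W^⊥} (P_W|_V)⁻¹ : W → W^⊥`. -/
def ResGr.chartOp (W V : ResGr Hp) : ResGr.space W →L[ℂ] (ResGr.space W)ᗮ :=
  ((ResGr.space W)ᗮ.orthogonalProjectionOnto ∘L (ResGr.space V).subtypeL) ∘L
    ContinuousLinearMap.inverse
      ((ResGr.space W).orthogonalProjectionOnto ∘L (ResGr.space V).subtypeL)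

/-- The chart `V ↦ P_{W^⊥} (P_W|_V)⁻¹ ∈ L²(W, W^⊥)` centred at `W`. -/
def ResGr.chart (W V : ResGr Hp) : HilbertSchmidt (ResGr.space W) (ResGr.space W)ᗮ :=
  HilbertSchmidt.ofCLM (ResGr.chartOp W V)

end Grassmannian

/-! ### The restricted unitary group and local sections -/

section ResUnitary

variable {H : Type*} [NormedAddCommGroup H] [InnerProductSpace ℂ H] [CompleteSpace H]
variable (Hp : Submodule ℂ H) [CompleteSpace Hp]

/-- The map `X ↦ [X, P₊]`, where `P₊` is the orthogonal projector onto `H₊`. -/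
def commProj : (H →L[ℂ] H) →ₗ[ℂ] (H →L[ℂ] H) :=
  LinearMap.mulRight ℂ Hp.starProjection - LinearMap.mulLeft ℂ Hp.starProjection

/-- The algebra of all bounded operators `X` with `[X, P₊]` Hilbert-Schmidt. -/
def ResOp : Type _ := (hsSubmodule H H).comap (commProj Hp)

instance : AddCommGroup (ResOp Hp) :=
  inferInstanceAs (AddCommGroup ((hsSubmodule H H).comap (commProj Hp)))

instance : Module ℂ (ResOp Hp) :=
  inferInstanceAs (Module ℂ ((hsSubmodule H H).comap (commProj Hp)))

/-- The inclusion into the bounded operators. -/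
def ResOp.toCLM : ResOp Hp →ₗ[ℂ] (H →L[ℂ] H) := ((hsSubmodule H H).comap (commProj Hp)).subtype

/-- The map `X ↦ (X, [X, P₊])`. -/
def ResOp.pair : ResOp Hp →ₗ[ℂ] (H →L[ℂ] H) × HilbertSchmidt H H where
  toFun X := (ResOp.toCLM Hp X, ⟨commProj Hp (ResOp.toCLM Hp X), X.2⟩)
  map_add' X Y := Prod.ext rfl (Subtype.ext (map_add (commProj Hp) X.1 Y.1))
  map_smul' c X := Prod.ext rfl (Subtype.ext (map_smul (commProj Hp) c X.1))

theorem ResOp.pair_injective : Function.Injective (ResOp.pair Hp) := fun _ _ h =>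
  Subtype.ext (congrArg Prod.fst h)

/-- The norm `max (‖X‖, ‖[X, P₊]‖₂)`, which defines the topology and the manifold structure of the
restricted unitary group as a real submanifold of `ResOp Hp`. -/
instance : NormedAddCommGroup (ResOp Hp) :=
  NormedAddCommGroup.induced _ _ (ResOp.pair Hp) (ResOp.pair_injective Hp)

instance : NormedSpace ℂ (ResOp Hp) := NormedSpace.induced ℂ _ _ (ResOp.pair Hp)

/-- The restricted unitary group: all unitary `g` with `[g, P₊]` Hilbert-Schmidt. -/
def ResUnitary : Set (ResOp Hp) := {g | ResOp.toCLM Hp g ∈ unitary (H →L[ℂ] H)}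

/-- A smooth local section `σ : Ω → U_res` of `g ↦ g H₊`, on an open set `Ω` of the restricted
Grassmannian which contains `W` and lies in the domain of the chart centred at `W`. -/
structure LocalSection where
  /-- the point `W` -/
  base : ResGr Hp
  /-- the open set `Ω` -/
  dom : Set (ResGr Hp)
  /-- the section `σ` (only its values on `Ω` matter) -/
  toFun : ResGr Hp → ResOp Hp
  base_mem : base ∈ dom
  dom_subset : dom ⊆ ResGr.chartDomain base
  isOpen_dom : IsOpen (ResGr.chart base '' dom)
  mem_resUnitary : ∀ V ∈ dom, toFun V ∈ ResUnitary Hp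
  map_eq : ∀ V ∈ dom, Hp.map (ResOp.toCLM Hp (toFun V)).toLinearMap = ResGr.space V
  /-- `σ` is smooth, read in the chart centred at `W` -/
  smooth : ∃ g : HilbertSchmidt (ResGr.space base) (ResGr.space base)ᗮ → ResOp Hp,
    ContDiffOn ℝ ∞ g (ResGr.chart base '' dom) ∧ ∀ V ∈ dom, g (ResGr.chart base V) = toFun V

end ResUnitary

/-! ### The unitary group of `H₊` -/

section UnitaryCharts

variable (K : Type*) [NormedAddCommGroup K] [InnerProductSpace ℂ K] [CompleteSpace K]

/-- The real Banach space of skew-adjoint bounded operators on `K`, with the operator norm. -/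
abbrev SkewOp : Type _ := skewAdjoint.submodule ℝ (K →L[ℂ] K)

/-- A chart of the unitary group `U(K)`, a real submanifold of the bounded operators with the
operator norm, with values in its Lie algebra. -/
structure UnitaryChart where
  /-- the domain `V` -/
  dom : Set (K →L[ℂ] K)
  /-- the chart `ψ` (only its values on `V` matter) -/
  toFun : (K →L[ℂ] K) → SkewOp K
  /-- `V` is an open subset of the unitary group -/
  isOpen_dom : ∃ O : Set (K →L[ℂ] K), IsOpen O ∧ dom = O ∩ unitary (K →L[ℂ] K)
  isOpen_image : IsOpen (toFun '' dom)
  smooth : ContDiffOn ℝ ∞ toFun dom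
  /-- `ψ` has a smooth inverse -/
  smooth_inv : ∃ g : SkewOp K → (K →L[ℂ] K),
    ContDiffOn ℝ ∞ g (toFun '' dom) ∧ ∀ u ∈ dom, g (toFun u) = u

end UnitaryCharts

/-! ### Partial isometries over the restricted Grassmannian -/

section PartialIsometries

variable {H : Type*} [NormedAddCommGroup H] [InnerProductSpace ℂ H] [CompleteSpace H]

/-- `u` is a partial isometry: `u* u` is an orthogonal projector. -/
def IsPartialIsometry (u : H →L[ℂ] H) : Prop := IsStarProjection (star u * u)

variable (Hp : Submodule ℂ H) [CompleteSpace Hp]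

/-- The groupoid of partial isometries `u` with `u* u` and `u u*` in the restricted
Grassmannian. -/
def URes : Set (H →L[ℂ] H) :=
  {u | IsPartialIsometry u ∧ star u * u ∈ ResGr Hp ∧ u * star u ∈ ResGr Hp}

variable {Hp}

/-- The source map `s(u) = u* u`. -/
def URes.source (u : URes Hp) : ResGr Hp := ⟨star u.1 * u.1, u.2.2.1⟩

/-- The target map `t(u) = u u*`. -/
def URes.target (u : URes Hp) : ResGr Hp := ⟨u.1 * star u.1, u.2.2.2⟩

variable (Hp)

/-- The indices of the charts of the groupoid: a chart of `U(H₊)`, a local section used at the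
source, and a local section used at the target. -/
structure URes.ChartIndex where
  α : UnitaryChart Hp
  β : LocalSection Hp
  γ : LocalSection Hp

variable {Hp}

/-- The operator `σ_γ(u u*)⁻¹ u σ_β(u* u)|_{H₊}` on `H₊`. -/
def URes.transport (β γ : LocalSection Hp) (u : URes Hp) : Hp →L[ℂ] Hp :=
  Hp.orthogonalProjectionOnto ∘L
    (star (ResOp.toCLM Hp (γ.toFun (URes.target u))) * u.1 * ResOp.toCLM Hp (β.toFun (URes.source u))) ∘L
    Hp.subtypeL

/-- The domain of a chart of the groupoid. -/
def URes.chartDomain (i : URes.ChartIndex Hp) : Set (URes Hp) :=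
  {u | URes.source u ∈ i.β.dom ∧ URes.target u ∈ i.γ.dom ∧ URes.transport i.β i.γ u ∈ i.α.dom}

/-- The model space `L²(W_γ, W_γ^⊥) × L²(W_β, W_β^⊥) × 𝔲₊` of a chart of the groupoid. -/
abbrev URes.Model (i : URes.ChartIndex Hp) : Type _ :=
  HilbertSchmidt (ResGr.space i.γ.base) (ResGr.space i.γ.base)ᗮ ×
    HilbertSchmidt (ResGr.space i.β.base) (ResGr.space i.β.base)ᗮ × SkewOp Hp

/-- The charts of the groupoid. -/
def URes.chart (i : URes.ChartIndex Hp) (u : URes Hp) : URes.Model i :=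
  (ResGr.chart i.γ.base (URes.target u), ResGr.chart i.β.base (URes.source u),
    i.α.toFun (URes.transport i.β i.γ u))

end PartialIsometries

end

/-!
A closed subspace `W` is in the restricted Grassmannian if and only if `P_W - P₊` is
Hilbert-Schmidt; if it is, `P_W|H₊` inverts `P₊|W` up to compact operators. Hence all these `W`, and
likewise all `W^⊥`, are infinite-dimensional and separable. The resulting unitaries between them
give transitivity, the identification of the model spaces, and a unitary `g` carrying `H₊` onto `W`.

The subspaces complementary to `W^⊥` are the graphs of the operators `T : W → W^⊥`. Let `S` be the
skew-adjoint extension `T - T*` of `T` to `H`. It anticommutes with the reflection `r = 2 P_W - 1`,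
and the reflection in the graph `V` of `T` is `(1 + S) (1 - S)⁻¹ r`, so `P_V = P_W + S (1 - S)⁻¹ r`.
Thus `P_V` is a smooth function of `T`, and `P_V - P_W` is Hilbert-Schmidt if `T` is.

A unitary carrying `W` onto `V` is obtained by halving the angle of this rotation: near `0` the
inverse function theorem solves `S (1 + X²) = 2 X` for the extension `X` of a second operator
`W → W^⊥`, and the Cayley transform `(1 + X) (1 - X)⁻¹` then squares to `(1 + S) (1 - S)⁻¹`.
Composed with `g` it is a local section `σ`, smooth into the restricted algebra because
`[σ(V), P₊] = (P_V - P₊) σ(V)`.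

In a chart of the groupoid, `u` is `σ_γ(u u*) τ P₊ σ_β(u* u)⁻¹` with `τ` unitary on `H₊`, and the
unitary group of `H₊` has Cayley transforms as charts.
-/

noncomputable section

section HilbertSchmidtOperators

open ContinuousLinearMap (adjoint)

variable {E F G : Type*} [NormedAddCommGroup E] [InnerProductSpace ℂ E] [CompleteSpace E]
  [NormedAddCommGroup F] [InnerProductSpace ℂ F] [NormedAddCommGroup G] [InnerProductSpace ℂ G]

theorem isHilbertSchmidt_iff_tsum_ne_top (T : E →L[ℂ] F) :
    IsHilbertSchmidt T ↔ ∑' i, ‖T (hsBasis E i)‖ₑ ^ 2 ≠ ⊤ := by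
  have henorm : (fun i => ‖T (hsBasis E i)‖ₑ ^ 2) =
      fun i => ENNReal.ofReal (‖T (hsBasis E i)‖ ^ 2) := by
    ext i
    rw [ENNReal.ofReal_pow (norm_nonneg _), ofReal_norm]
  rw [henorm, IsHilbertSchmidt]
  refine ⟨fun h => h.tsum_ofReal_ne_top, fun h => ?_⟩
  simpa [ENNReal.toReal_ofReal, sq_nonneg] using ENNReal.summable_toReal h

theorem tsum_enorm_sq_comp_le (A : F →L[ℂ] G) (T : E →L[ℂ] F) :
    ∑' i, ‖(A ∘L T) (hsBasis E i)‖ₑ ^ 2 ≤ ‖A‖ₑ ^ 2 * ∑' i, ‖T (hsBasis E i)‖ₑ ^ 2 := by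
  rw [← ENNReal.tsum_mul_left]
  refine ENNReal.tsum_le_tsum fun i => ?_
  rw [← mul_pow]
  exact pow_le_pow_left' (A.le_opENorm _) 2

namespace IsHilbertSchmidt

theorem comp_left {T : E →L[ℂ] F} (hT : IsHilbertSchmidt T) (A : F →L[ℂ] G) :
    IsHilbertSchmidt (A ∘L T) := by
  rw [isHilbertSchmidt_iff_tsum_ne_top] at hT ⊢
  exact ne_top_of_le_ne_top (ENNReal.mul_ne_top (by simp) hT) (tsum_enorm_sq_comp_le A T)

theorem of_finiteDimensional_left [FiniteDimensional ℂ E] (T : E →L[ℂ] F) :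
    IsHilbertSchmidt T :=
  have : Finite (hsIndex E) := (hsBasis E).orthonormal.linearIndependent.finite
  Summable.of_finite

end IsHilbertSchmidt

theorem finiteDimensional_of_finite_hsIndex [Finite (hsIndex E)] : FiniteDimensional ℂ E := by
  have hfin : FiniteDimensional ℂ (Submodule.span ℂ (Set.range (hsBasis E))) :=
    FiniteDimensional.span_of_finite ℂ (Set.finite_range _)
  have htop := (hsBasis E).dense_span
  rw [(Submodule.closed_of_finiteDimensional _).submodule_topologicalClosure_eq] at htop
  rw [htop] at hfin
  exact Module.finite_def.2 (Submodule.fg_top _ |>.1 (Module.finite_def.1 hfin))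

theorem finiteDimensional_of_isHilbertSchmidt_id
    (h : IsHilbertSchmidt (ContinuousLinearMap.id ℂ E)) : FiniteDimensional ℂ E := by
  have hsum : Summable fun _ : hsIndex E => (1 : ℝ) := by
    simpa [IsHilbertSchmidt, (hsBasis E).orthonormal.1] using h
  have : Finite (hsIndex E) := by
    by_contra hinf
    rw [not_finite_iff_infinite] at hinf
    exact one_ne_zero ((summable_const_iff _).1 hsum)
  exact finiteDimensional_of_finite_hsIndex

/-- The operator that agrees with `T` on the finitely many basis vectors `eᵢ`, `i ∈ s`, and
vanishes on the others. -/
def hsTruncation (T : E →L[ℂ] F) (s : Finset (hsIndex E)) : E →L[ℂ] F :=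
  ∑ i ∈ s, (innerSL ℂ (hsBasis E i)).smulRight (T (hsBasis E i))

open Classical in
theorem hsTruncation_apply_hsBasis (T : E →L[ℂ] F) (s : Finset (hsIndex E)) (i : hsIndex E) :
    hsTruncation T s (hsBasis E i) = if i ∈ s then T (hsBasis E i) else 0 := by
  simp [hsTruncation, orthonormal_iff_ite.1 (hsBasis E).orthonormal]

theorem hasFiniteRange_hsTruncation (T : E →L[ℂ] F) (s : Finset (hsIndex E)) :
    (hsTruncation T s).toLinearMap.HasFiniteRange := by
  let R : Submodule ℂ F := Submodule.span ℂ ((fun i => T (hsBasis E i)) '' (s : Set (hsIndex E)))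
  have : FiniteDimensional ℂ R :=
    FiniteDimensional.span_of_finite ℂ (s.finite_toSet.image _)
  have hle : (hsTruncation T s).toLinearMap.range ≤ R := by
    rintro _ ⟨x, rfl⟩
    simp only [hsTruncation, ContinuousLinearMap.coe_coe, sum_apply,
      ContinuousLinearMap.smulRight_apply]
    exact Submodule.sum_mem _ fun i hi => R.smul_mem _ (Submodule.subset_span ⟨i, hi, rfl⟩)
  exact Module.Finite.iff_fg.1 (Submodule.finiteDimensional_of_le hle)

theorem tsum_enorm_sq_sub_hsTruncation (T : E →L[ℂ] F) (s : Finset (hsIndex E)) :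
    ∑' i, ‖(T - hsTruncation T s) (hsBasis E i)‖ₑ ^ 2 =
      ∑' i : {i // i ∉ s}, ‖T (hsBasis E i)‖ₑ ^ 2 := by
  classical
  refine Eq.trans (tsum_congr fun i => ?_)
    (tsum_subtype {i | i ∉ s} fun i => ‖T (hsBasis E i)‖ₑ ^ 2).symm
  rw [sub_apply, hsTruncation_apply_hsBasis]
  by_cases hi : i ∈ s <;> simp [hi]

variable [CompleteSpace F]

theorem enorm_sq_adjoint_apply_le (T : E →L[ℂ] F) (y : F) :
    ‖adjoint T y‖ₑ ^ 2 ≤ (∑' i, ‖T (hsBasis E i)‖ₑ ^ 2) * ‖y‖ₑ ^ 2 := by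
  rw [← tsum_enorm_inner_sq (hsBasis E), ← ENNReal.tsum_mul_right]
  refine ENNReal.tsum_le_tsum fun i => ?_
  rw [ContinuousLinearMap.adjoint_inner_right, ← mul_pow]
  refine pow_le_pow_left' ?_ 2
  simp only [← ofReal_norm, ← ENNReal.ofReal_mul (norm_nonneg _)]
  exact ENNReal.ofReal_le_ofReal (norm_inner_le_norm _ _)

theorem enorm_sq_le_tsum (T : E →L[ℂ] F) : ‖T‖ₑ ^ 2 ≤ ∑' i, ‖T (hsBasis E i)‖ₑ ^ 2 := by
  set S := ∑' i, ‖T (hsBasis E i)‖ₑ ^ 2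
  have hroot : (S ^ (2 : ℝ)⁻¹) ^ 2 = S := by
    rw [← ENNReal.rpow_natCast, ← ENNReal.rpow_mul]
    norm_num
  have hadj : ‖adjoint T‖ₑ ≤ S ^ (2 : ℝ)⁻¹ := by
    refine ContinuousLinearMap.opENorm_le_bound _ fun y => ?_
    rw [← ENNReal.pow_le_pow_left_iff two_ne_zero, mul_pow, hroot]
    exact enorm_sq_adjoint_apply_le T y
  rw [LinearIsometryEquiv.enorm_map] at hadj
  exact (pow_le_pow_left' hadj 2).trans_eq hroot

namespace IsHilbertSchmidt

theorem adjoint {T : E →L[ℂ] F} (hT : IsHilbertSchmidt T) : IsHilbertSchmidt (adjoint T) := by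
  rw [isHilbertSchmidt_iff_tsum_ne_top] at hT ⊢
  rwa [← tsum_enorm_sq_adjoint T (hsBasis E) (hsBasis F)]

theorem comp_right [CompleteSpace G] {T : F →L[ℂ] G} (hT : IsHilbertSchmidt T) (A : E →L[ℂ] F) :
    IsHilbertSchmidt (T ∘L A) := by
  have h := (hT.adjoint.comp_left (ContinuousLinearMap.adjoint A)).adjoint
  rwa [← ContinuousLinearMap.adjoint_comp, ContinuousLinearMap.adjoint_adjoint] at h

theorem add {S T : E →L[ℂ] F} (hS : IsHilbertSchmidt S) (hT : IsHilbertSchmidt T) :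
    IsHilbertSchmidt (S + T) :=
  (hsSubmodule E F).add_mem hS hT

theorem neg {S : E →L[ℂ] F} (hS : IsHilbertSchmidt S) : IsHilbertSchmidt (-S) :=
  (hsSubmodule E F).neg_mem hS

theorem sub {S T : E →L[ℂ] F} (hS : IsHilbertSchmidt S) (hT : IsHilbertSchmidt T) :
    IsHilbertSchmidt (S - T) :=
  (hsSubmodule E F).sub_mem hS hT

theorem of_finiteDimensional_right [FiniteDimensional ℂ F] (T : E →L[ℂ] F) :
    IsHilbertSchmidt T := by
  have h := (of_finiteDimensional_left (ContinuousLinearMap.adjoint T)).adjoint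
  rwa [ContinuousLinearMap.adjoint_adjoint] at h

omit [CompleteSpace F] in
theorem of_hasFiniteRange {T : E →L[ℂ] F} (hT : T.toLinearMap.HasFiniteRange) :
    IsHilbertSchmidt T :=
  have : FiniteDimensional ℂ T.range := Module.Finite.of_fg hT
  (of_finiteDimensional_right (T.codRestrict T.range fun x => ⟨x, rfl⟩)).comp_left T.range.subtypeL

theorem exists_hasFiniteRange_norm_sub_lt {T : E →L[ℂ] F}
    (hT : IsHilbertSchmidt T) {ε : ℝ} (hε : 0 < ε) :
    ∃ R : E →L[ℂ] F, R.toLinearMap.HasFiniteRange ∧ ‖T - R‖ < ε := by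
  have htail := ENNReal.tendsto_tsum_compl_atTop_zero ((isHilbertSchmidt_iff_tsum_ne_top T).1 hT)
  have hε' : (0 : ℝ≥0∞) < ENNReal.ofReal ε ^ 2 := by positivity
  obtain ⟨s, hs⟩ := (htail.eventually_lt_const hε').exists
  refine ⟨hsTruncation T s, hasFiniteRange_hsTruncation T s, ?_⟩
  have hsq : ‖T - hsTruncation T s‖ₑ ^ 2 < ENNReal.ofReal ε ^ 2 :=
    (enorm_sq_le_tsum _).trans_lt ((tsum_enorm_sq_sub_hsTruncation T s).trans_lt hs)
  rw [ENNReal.pow_lt_pow_left_iff two_ne_zero, ← ofReal_norm] at hsq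
  exact (ENNReal.ofReal_lt_ofReal_iff hε).1 hsq

end IsHilbertSchmidt

end HilbertSchmidtOperators

/-! ### The Banach space of Hilbert-Schmidt operators -/

namespace HilbertSchmidt

variable {E F G : Type*} [NormedAddCommGroup E] [InnerProductSpace ℂ E] [CompleteSpace E]
  [NormedAddCommGroup F] [InnerProductSpace ℂ F] [CompleteSpace F]
  [NormedAddCommGroup G] [InnerProductSpace ℂ G] [CompleteSpace G]

open ContinuousLinearMap (adjoint)

/-- A bounded operator that is Hilbert-Schmidt, as an element of `L²(E, F)`. -/
def mk (T : E →L[ℂ] F) (hT : IsHilbertSchmidt T) : HilbertSchmidt E F := ⟨T, hT⟩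

@[simp]
theorem toCLM_mk (T : E →L[ℂ] F) (hT : IsHilbertSchmidt T) : toCLM E F (mk T hT) = T := rfl

theorem toCLM_injective : Function.Injective (toCLM E F) := Subtype.val_injective

theorem isHilbertSchmidt (T : HilbertSchmidt E F) : IsHilbertSchmidt (toCLM E F T) := T.2

theorem toCLM_ofCLM {T : E →L[ℂ] F} (hT : IsHilbertSchmidt T) : toCLM E F (ofCLM T) = T := by
  have hmk : ofCLM T = mk T hT := dif_pos hT
  rw [hmk, toCLM_mk]

theorem enorm_sq_eq (T : HilbertSchmidt E F) :
    ‖T‖ₑ ^ 2 = ∑' i, ‖toCLM E F T (hsBasis E i)‖ₑ ^ 2 := by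
  rw [← ofReal_norm, ← ENNReal.ofReal_pow (norm_nonneg _), norm_sq_eq,
    ENNReal.ofReal_tsum_of_nonneg (fun _ => by positivity) T.isHilbertSchmidt]
  congr with i
  rw [ENNReal.ofReal_pow (norm_nonneg _), ofReal_norm]

theorem norm_toCLM_le (T : HilbertSchmidt E F) : ‖toCLM E F T‖ ≤ ‖T‖ := by
  rw [← enorm_le_iff_norm_le, ← ENNReal.pow_le_pow_left_iff two_ne_zero, enorm_sq_eq]
  exact enorm_sq_le_tsum _

variable (E F) in
/-- The inclusion of `L²(E, F)` into the bounded operators, as a bounded linear map. -/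
def toCLML : HilbertSchmidt E F →L[ℂ] (E →L[ℂ] F) :=
  (toCLM E F).mkContinuous 1 fun T => by simpa using norm_toCLM_le T

@[simp]
theorem toCLM_real_smul (c : ℝ) (T : HilbertSchmidt E F) :
    toCLM E F (c • T) = c • toCLM E F T :=
  (toCLM E F).map_smul (c : ℂ) T

/-- The adjoint `L²(E, F) → L²(F, E)`, as a real-linear isometry. -/
def adjointₗᵢ : HilbertSchmidt E F →ₗᵢ[ℝ] HilbertSchmidt F E where
  toFun T := mk (adjoint (toCLM E F T)) T.isHilbertSchmidt.adjoint
  map_add' S T := toCLM_injective (by simp)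
  map_smul' c T := toCLM_injective (by
    have hstar := map_smulₛₗ (adjoint (𝕜 := ℂ) (E := E) (F := F)) (c : ℂ) (toCLM E F T)
    rw [RingHom.id_apply, toCLM_mk, toCLM_real_smul, toCLM_real_smul, toCLM_mk]
    simpa using hstar)
  norm_map' T := by
    refine (enorm_eq_iff_norm_eq.1 (ENNReal.pow_right_strictMono two_ne_zero |>.injective ?_))
    rw [enorm_sq_eq, enorm_sq_eq T, tsum_enorm_sq_adjoint _ (hsBasis E) (hsBasis F)]
    rfl

@[simp]
theorem toCLM_adjointₗᵢ (T : HilbertSchmidt E F) :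
    toCLM F E (adjointₗᵢ T) = adjoint (toCLM E F T) := rfl

theorem norm_mk_comp_left_le (A : F →L[ℂ] G) (T : HilbertSchmidt E F) :
    ‖mk (A ∘L toCLM E F T) (T.isHilbertSchmidt.comp_left A)‖ ≤ ‖A‖ * ‖T‖ := by
  have hle := tsum_enorm_sq_comp_le A (toCLM E F T)
  rw [← enorm_sq_eq T, ← mul_pow] at hle
  rw [← norm_norm A, ← norm_norm T, ← norm_mul, ← enorm_le_iff_norm_le,
    ← ENNReal.pow_le_pow_left_iff two_ne_zero, enorm_mul, enorm_norm, enorm_norm, enorm_sq_eq]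
  exact hle

theorem norm_mk_comp_right_le (T : HilbertSchmidt F G) (A : E →L[ℂ] F) :
    ‖mk (toCLM F G T ∘L A) (T.isHilbertSchmidt.comp_right A)‖ ≤ ‖T‖ * ‖A‖ := by
  have hadj : adjointₗᵢ (mk (toCLM F G T ∘L A) (T.isHilbertSchmidt.comp_right A)) =
      mk (adjoint A ∘L toCLM G F (adjointₗᵢ T)) ((adjointₗᵢ T).isHilbertSchmidt.comp_left _) :=
    toCLM_injective (by simp [ContinuousLinearMap.adjoint_comp])
  rw [← adjointₗᵢ.norm_map, hadj, mul_comm, ← adjointₗᵢ.norm_map T,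
    ← LinearIsometryEquiv.norm_map ContinuousLinearMap.adjoint A]
  exact norm_mk_comp_left_le _ _

/-- Composition `(A, T) ↦ A ∘ T` with a bounded operator on the left, as a bounded bilinear map. -/
def compLeft : (F →L[ℂ] G) →L[ℂ] HilbertSchmidt E F →L[ℂ] HilbertSchmidt E G :=
  LinearMap.mkContinuous₂
    (LinearMap.mk₂ ℂ (fun A T => mk (A ∘L toCLM E F T) (T.isHilbertSchmidt.comp_left A))
      (fun _ _ _ => toCLM_injective (by simp)) (fun _ _ _ => toCLM_injective (by simp))
      (fun _ _ _ => toCLM_injective (by simp)) (fun _ _ _ => toCLM_injective (by simp)))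
    1 fun A T => by
      rw [one_mul]
      exact norm_mk_comp_left_le A T

@[simp]
theorem toCLM_compLeft (A : F →L[ℂ] G) (T : HilbertSchmidt E F) :
    toCLM E G (compLeft A T) = A ∘L toCLM E F T := rfl

/-- Composition `(T, A) ↦ T ∘ A` with a bounded operator on the right, as a bounded bilinear
map. -/
def compRight : HilbertSchmidt F G →L[ℂ] (E →L[ℂ] F) →L[ℂ] HilbertSchmidt E G :=
  LinearMap.mkContinuous₂
    (LinearMap.mk₂ ℂ (fun T A => mk (toCLM F G T ∘L A) (T.isHilbertSchmidt.comp_right A))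
      (fun _ _ _ => toCLM_injective (by simp)) (fun _ _ _ => toCLM_injective (by simp))
      (fun _ _ _ => toCLM_injective (by simp)) (fun _ _ _ => toCLM_injective (by simp)))
    1 fun T A => by
      rw [one_mul]
      exact norm_mk_comp_right_le T A

@[simp]
theorem toCLM_compRight (T : HilbertSchmidt F G) (A : E →L[ℂ] F) :
    toCLM E G (compRight T A) = toCLM F G T ∘L A := rfl

theorem isometry_coord : Isometry (coord E F) :=
  AddMonoidHomClass.isometry_of_norm (coord E F) fun _ => rfl

/-- A Cauchy sequence converges in `ℓ²` along `coord` and in operator norm; the `ℓ²` limit is the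
family of coordinates of the operator norm limit. -/
instance : CompleteSpace (HilbertSchmidt E F) := by
  refine Metric.complete_of_cauchySeq_tendsto fun u hu => ?_
  obtain ⟨f, hf⟩ :=
    cauchySeq_tendsto_of_complete (isometry_coord.uniformContinuous.comp_cauchySeq hu)
  obtain ⟨T, hT⟩ := cauchySeq_tendsto_of_complete
    ((toCLML E F).uniformContinuous.comp_cauchySeq hu)
  have hval (i) : T (hsBasis E i) = f i := by
    have happly := ((ContinuousLinearMap.apply ℂ F (hsBasis E i)).continuous.tendsto T).comp hT
    have hcoe := (lp.uniformContinuous_coe (E := fun _ : hsIndex E => F) (p := 2)).continuous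
    exact tendsto_nhds_unique happly (tendsto_pi_nhds.1 ((hcoe.tendsto f).comp hf) i)
  have hHS : IsHilbertSchmidt T := by
    simp only [isHilbertSchmidt_iff_memℓp, hval]
    exact f.2
  have hcoord : coord E F (mk T hHS) = f :=
    Subtype.ext (funext hval)
  refine ⟨mk T hHS, ?_⟩
  rw [isometry_coord.isEmbedding.isInducing.tendsto_nhds_iff, hcoord]
  exact hf

end HilbertSchmidt

section Fredholm

variable {E F : Type*} [NormedAddCommGroup E] [InnerProductSpace ℂ E]
  [NormedAddCommGroup F] [InnerProductSpace ℂ F]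

theorem isFredholm_of_comp_comp {A : E →L[ℂ] F} {B : F →L[ℂ] E} (hBA : (B ∘L A).IsFredholm)
    (hAB : (A ∘L B).IsFredholm) : A.IsFredholm := by
  obtain ⟨R, hR⟩ := hBA.exists_isQuasiInverse
  obtain ⟨S, hS⟩ := hAB.exists_isQuasiInverse
  have hB : (A ∘L R).toLinearMap.IsRightQuasiInverse B.toLinearMap := hR.2
  exact ContinuousLinearMap.IsFredholm.of_isQuasiInverse (v := B ∘L S)
    ⟨LinearMap.IsLeftQuasiInverse.of_comp_left hB hS.1, hS.2⟩

variable [CompleteSpace E]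

open scoped LinearMap.FiniteRangeSetoid in
theorem IsHilbertSchmidt.isFredholm_one_add {K : E →L[ℂ] E} (hK : IsHilbertSchmidt K) :
    (1 + K).IsFredholm := by
  obtain ⟨N, hN, hsmall⟩ := hK.exists_hasFiniteRange_norm_sub_lt one_pos
  obtain ⟨u, hu⟩ : IsUnit (1 - (N - K)) :=
    isUnit_one_sub_of_norm_lt_one (by rwa [norm_sub_rev])
  have hequiv : (1 + K).toLinearMap ≈ (u : E →L[ℂ] E).toLinearMap := by
    have hsub : 1 + K - u = N := by rw [hu]; abel
    rwa [LinearMap.FiniteRangeSetoid.equiv_iff_hasFiniteRange,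
      ← ContinuousLinearMap.toLinearMap_sub, hsub]
  have hinv := (ContinuousLinearEquiv.ofUnit u).toLinearEquiv.isQuasiInverse
  exact ContinuousLinearMap.IsFredholm.of_isQuasiInverse (v := ((u⁻¹ : (E →L[ℂ] E)ˣ) : E →L[ℂ] E))
    (hinv.congr (Setoid.refl _) hequiv)

theorem isFredholm_of_isHilbertSchmidt [CompleteSpace F] {A : E →L[ℂ] F} {B : F →L[ℂ] E}
    (hBA : IsHilbertSchmidt (B ∘L A - ContinuousLinearMap.id ℂ E))
    (hAB : IsHilbertSchmidt (A ∘L B - ContinuousLinearMap.id ℂ F)) : A.IsFredholm := by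
  refine isFredholm_of_comp_comp (B := B) ?_ ?_
  · simpa only [ContinuousLinearMap.one_def, add_sub_cancel] using hBA.isFredholm_one_add
  · simpa only [ContinuousLinearMap.one_def, add_sub_cancel] using hAB.isFredholm_one_add

end Fredholm

section SeparableHilbert

variable {E : Type*} [NormedAddCommGroup E] [InnerProductSpace ℂ E]

open TopologicalSpace (SeparableSpace)

theorem countable_of_orthonormal [SeparableSpace E] {ι : Type*} {v : ι → E}
    (hv : Orthonormal ℂ v) : Countable ι := by
  have hdist {i j : ι} (hij : i ≠ j) : 1 ≤ dist (v i) (v j) := by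
    have hsq : ‖v i - v j‖ ^ 2 = 2 := by
      rw [norm_sub_sq (𝕜 := ℂ), hv.2 hij, hv.1, hv.1]
      norm_num
    rw [dist_eq_norm]
    nlinarith [norm_nonneg (v i - v j)]
  have hdisj : Set.univ.PairwiseDisjoint fun i => Metric.ball (v i) (1 / 2) :=
    fun i _ j _ hij => Metric.ball_disjoint_ball (by linarith [hdist hij])
  exact Set.countable_univ_iff.1 <| hdisj.countable_of_isOpen (fun _ _ => Metric.isOpen_ball)
    fun i _ => Metric.nonempty_ball.2 (by norm_num)

variable [CompleteSpace E] {F : Type*} [NormedAddCommGroup F] [InnerProductSpace ℂ F]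
  [CompleteSpace F]

theorem nonempty_hilbertBasis_nat [SeparableSpace E] (hE : ¬ FiniteDimensional ℂ E) :
    Nonempty (HilbertBasis ℕ ℂ E) := by
  have : Countable (hsIndex E) := countable_of_orthonormal (hsBasis E).orthonormal
  have : Infinite (hsIndex E) :=
    not_finite_iff_infinite.1 fun _ => hE finiteDimensional_of_finite_hsIndex
  obtain ⟨e⟩ := nonempty_equiv_of_countable (α := ℕ) (β := hsIndex E)
  refine ⟨HilbertBasis.mk (v := hsBasis E ∘ e) ((hsBasis E).orthonormal.comp e e.injective) ?_⟩
  rw [e.surjective.range_comp, (hsBasis E).dense_span]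

theorem nonempty_linearIsometryEquiv [SeparableSpace E] [SeparableSpace F]
    (hE : ¬ FiniteDimensional ℂ E) (hF : ¬ FiniteDimensional ℂ F) : Nonempty (E ≃ₗᵢ[ℂ] F) := by
  obtain ⟨b⟩ := nonempty_hilbertBasis_nat hE
  obtain ⟨c⟩ := nonempty_hilbertBasis_nat hF
  exact ⟨b.repr.trans c.repr.symm⟩

/-- The isomorphism `L²(E, F) ≃ L²(E', F')`, `T ↦ f T e⁻¹`, induced by isometries `e : E ≃ E'` and
`f : F ≃ F'`. -/
def HilbertSchmidt.congr {E' F' : Type*} [NormedAddCommGroup E'] [InnerProductSpace ℂ E']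
    [CompleteSpace E'] [NormedAddCommGroup F'] [InnerProductSpace ℂ F'] [CompleteSpace F']
    (e : E ≃ₗᵢ[ℂ] E') (f : F ≃ₗᵢ[ℂ] F') : HilbertSchmidt E F ≃L[ℂ] HilbertSchmidt E' F' :=
  ContinuousLinearEquiv.equivOfInverse
    (compRight.flip (e.symm : E' →L[ℂ] E) ∘L compLeft (f : F →L[ℂ] F'))
    (compRight.flip (e : E →L[ℂ] E') ∘L compLeft (f.symm : F' →L[ℂ] F))
    (fun T => toCLM_injective (by ext x; simp))
    (fun T => toCLM_injective (by ext x; simp))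

end SeparableHilbert

/-! ### The restricted Grassmannian as a set of projectors -/

section Grassmannian

variable {H : Type*} [NormedAddCommGroup H] [InnerProductSpace ℂ H] [CompleteSpace H]

theorem IsHilbertSchmidt.of_comp_isFredholm {E F G : Type*} [NormedAddCommGroup E]
    [InnerProductSpace ℂ E] [CompleteSpace E] [NormedAddCommGroup F] [InnerProductSpace ℂ F]
    [CompleteSpace F] [NormedAddCommGroup G] [InnerProductSpace ℂ G] [CompleteSpace G]
    {A : E →L[ℂ] F} {D : F →L[ℂ] G} (hA : A.IsFredholm) (hDA : IsHilbertSchmidt (D ∘L A)) :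
    IsHilbertSchmidt D := by
  obtain ⟨B, -, hB⟩ := hA.exists_isQuasiInverse
  have hfin : IsHilbertSchmidt (A ∘L B - ContinuousLinearMap.id ℂ F) :=
    of_hasFiniteRange (LinearMap.FiniteRangeSetoid.equiv_iff_hasFiniteRange.1 hB)
  convert (hDA.comp_right B).sub (hfin.comp_left D) using 1
  ext x
  simp

theorem isRestricted_iff (Hp W : Submodule ℂ H) [CompleteSpace Hp] [CompleteSpace W] :
    IsRestricted Hp W ↔ IsHilbertSchmidt (W.starProjection - Hp.starProjection) := by
  refine ⟨fun ⟨hA, hC⟩ => ?_, fun h => ⟨isFredholm_of_isHilbertSchmidt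
    (B := W.orthogonalProjectionOnto ∘L Hp.subtypeL) ?_ ?_, ?_⟩⟩
  · have hD : IsHilbertSchmidt (Wᗮ.orthogonalProjectionOnto ∘L Hp.subtypeL) := by
      refine IsHilbertSchmidt.of_comp_isFredholm hA ?_
      convert (hC.comp_left (Wᗮ.orthogonalProjectionOnto ∘L Hpᗮ.subtypeL)).neg using 1
      ext x
      simp
    have hHpW : IsHilbertSchmidt ((1 - Hp.starProjection) * W.starProjection) := by
      convert (hC.comp_left Hpᗮ.subtypeL).comp_right W.orthogonalProjectionOnto using 1
      ext x
      simp
    have hWHp : IsHilbertSchmidt (Hp.starProjection * (1 - W.starProjection)) := by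
      convert ((hD.comp_left Wᗮ.subtypeL).comp_right Hp.orthogonalProjectionOnto).adjoint using 1
      rw [← Submodule.starProjection_orthogonal']
      simp only [ContinuousLinearMap.adjoint_comp, Submodule.adjoint_subtypeL,
        Submodule.adjoint_orthogonalProjectionOnto]
      rfl
    convert hHpW.sub hWHp using 1
    noncomm_ring
  · convert ((h.comp_left W.orthogonalProjectionOnto).comp_right W.subtypeL).neg using 1
    ext x
    simp
  · convert (h.comp_left Hp.orthogonalProjectionOnto).comp_right Hp.subtypeL using 1
    ext x
    simp
  · convert (h.comp_left Hpᗮ.orthogonalProjectionOnto).comp_right W.subtypeL using 1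
    ext x
    simp [Submodule.starProjection_eq_self_iff.2 (Hp.starProjection_apply_mem x)]

theorem finiteDimensional_of_isHilbertSchmidt_sub {U V : Submodule ℂ H} [CompleteSpace U]
    [CompleteSpace V] [FiniteDimensional ℂ U]
    (h : IsHilbertSchmidt (U.starProjection - V.starProjection)) : FiniteDimensional ℂ V := by
  have hU : IsHilbertSchmidt U.starProjection :=
    (IsHilbertSchmidt.of_finiteDimensional_right U.orthogonalProjectionOnto).comp_left U.subtypeL
  have hV : IsHilbertSchmidt V.starProjection := by
    simpa only [sub_sub_cancel] using hU.sub h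
  apply finiteDimensional_of_isHilbertSchmidt_id
  convert (hV.comp_left V.orthogonalProjectionOnto).comp_right V.subtypeL using 1
  ext x
  simp

theorem mem_resGr_iff {Hp : Submodule ℂ H} [CompleteSpace Hp] {p : H →L[ℂ] H} :
    p ∈ ResGr Hp ↔ IsStarProjection p ∧ IsHilbertSchmidt (p - Hp.starProjection) := by
  constructor
  · rintro ⟨W, hW, hr, rfl⟩
    exact ⟨isStarProjection_starProjection, (isRestricted_iff Hp W).1 hr⟩
  · rintro ⟨hp, hs⟩
    obtain ⟨W, hW, rfl⟩ := isStarProjection_iff_eq_starProjection.1 hp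
    have hclosed : IsClosed (W : Set H) := by
      rw [← W.orthogonal_orthogonal]
      exact Submodule.isClosed_orthogonal _
    have : CompleteSpace W := hclosed.completeSpace_coe
    exact ⟨W, this, (isRestricted_iff Hp W).2 hs, rfl⟩

namespace ResGr

variable {Hp : Submodule ℂ H} [CompleteSpace Hp]

theorem isStarProjection (p : ResGr Hp) : IsStarProjection (p : H →L[ℂ] H) :=
  (mem_resGr_iff.1 p.2).1

omit [CompleteSpace H] in
@[simp]
theorem starProjection_space (p : ResGr Hp) : (space p).starProjection = p := by
  obtain ⟨W, hW, -, h⟩ := p.2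
  have hspace : space p = W := by
    rw [space, ← h]
    exact W.range_starProjection
  rw [← h]
  congr 1

theorem isHilbertSchmidt_sub_base (p : ResGr Hp) :
    IsHilbertSchmidt ((p : H →L[ℂ] H) - Hp.starProjection) :=
  (mem_resGr_iff.1 p.2).2

theorem isHilbertSchmidt_sub (p q : ResGr Hp) : IsHilbertSchmidt (p - q : H →L[ℂ] H) := by
  simpa only [sub_sub_sub_cancel_right] using
    (isHilbertSchmidt_sub_base p).sub (isHilbertSchmidt_sub_base q)

omit [CompleteSpace H] in
theorem space_injective : Function.Injective (space (Hp := Hp)) := by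
  intro p q h
  apply Subtype.ext
  rw [← starProjection_space p, ← starProjection_space q]
  congr 1

theorem not_finiteDimensional_space (hp : ¬ FiniteDimensional ℂ Hp) (p : ResGr Hp) :
    ¬ FiniteDimensional ℂ (space p) := by
  intro h
  refine hp (finiteDimensional_of_isHilbertSchmidt_sub (U := space p) ?_)
  rw [starProjection_space]
  exact isHilbertSchmidt_sub_base p

theorem not_finiteDimensional_space_orthogonal (hm : ¬ FiniteDimensional ℂ Hpᗮ) (p : ResGr Hp) :
    ¬ FiniteDimensional ℂ (space p)ᗮ := by
  intro h
  refine hm (finiteDimensional_of_isHilbertSchmidt_sub (U := (space p)ᗮ) ?_)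
  rw [Submodule.starProjection_orthogonal', Submodule.starProjection_orthogonal',
    sub_sub_sub_cancel_left, starProjection_space, ← neg_sub]
  exact (isHilbertSchmidt_sub_base p).neg

theorem nonempty_model_equiv [TopologicalSpace.SeparableSpace H]
    (hp : ¬ FiniteDimensional ℂ Hp) (hm : ¬ FiniteDimensional ℂ Hpᗮ) (W : ResGr Hp) :
    Nonempty (HilbertSchmidt (space W) (space W)ᗮ ≃L[ℂ] HilbertSchmidt Hp Hpᗮ) := by
  obtain ⟨e⟩ := nonempty_linearIsometryEquiv (not_finiteDimensional_space hp W) hp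
  obtain ⟨f⟩ := nonempty_linearIsometryEquiv (not_finiteDimensional_space_orthogonal hm W) hm
  exact ⟨HilbertSchmidt.congr e f⟩

end ResGr

end Grassmannian

section Transitivity

variable {H : Type*} [NormedAddCommGroup H] [InnerProductSpace ℂ H] [CompleteSpace H]
  {U V : Submodule ℂ H} [CompleteSpace U]

/-- The partial isometry of `H` with initial space `U` and final space `V` given by an isometry
`U ≃ V`. -/
def extendIsometry (e : U ≃ₗᵢ[ℂ] V) : H →L[ℂ] H :=
  V.subtypeL ∘L (e : U →L[ℂ] V) ∘L U.orthogonalProjectionOnto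

omit [CompleteSpace H] in
theorem extendIsometry_symm_mul_self [CompleteSpace V] (e : U ≃ₗᵢ[ℂ] V) :
    extendIsometry e.symm * extendIsometry e = U.starProjection := by
  ext x
  simp [extendIsometry]

theorem star_extendIsometry [CompleteSpace V] (e : U ≃ₗᵢ[ℂ] V) :
    star (extendIsometry e) = extendIsometry e.symm := by
  simp only [ContinuousLinearMap.star_eq_adjoint, extendIsometry, ContinuousLinearMap.adjoint_comp,
    LinearIsometryEquiv.adjoint_eq_symm, Submodule.adjoint_subtypeL,
    Submodule.adjoint_orthogonalProjectionOnto, ContinuousLinearMap.comp_assoc]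

theorem star_extendIsometry_mul_self [CompleteSpace V] (e : U ≃ₗᵢ[ℂ] V) :
    star (extendIsometry e) * extendIsometry e = U.starProjection := by
  rw [star_extendIsometry, extendIsometry_symm_mul_self]

theorem extendIsometry_mul_star_self [CompleteSpace V] (e : U ≃ₗᵢ[ℂ] V) :
    extendIsometry e * star (extendIsometry e) = V.starProjection := by
  rw [star_extendIsometry]
  exact extendIsometry_symm_mul_self e.symm

theorem URes.source_target_surjective [TopologicalSpace.SeparableSpace H]
    {Hp : Submodule ℂ H} [CompleteSpace Hp] (hp : ¬ FiniteDimensional ℂ Hp) :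
    Function.Surjective fun u : URes Hp => (URes.source u, URes.target u) := by
  rintro ⟨p, q⟩
  obtain ⟨e⟩ := nonempty_linearIsometryEquiv (ResGr.not_finiteDimensional_space hp p)
    (ResGr.not_finiteDimensional_space hp q)
  have hsource := (star_extendIsometry_mul_self e).trans (ResGr.starProjection_space p)
  have htarget := (extendIsometry_mul_star_self e).trans (ResGr.starProjection_space q)
  refine ⟨⟨extendIsometry e, ?_, hsource ▸ p.2, htarget ▸ q.2⟩,
    Prod.ext (Subtype.ext hsource) (Subtype.ext htarget)⟩
  rw [IsPartialIsometry, hsource]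
  exact ResGr.isStarProjection p

end Transitivity

section Atlas

variable {M ι : Type*} {E : ι → Type*} [∀ i, NormedAddCommGroup (E i)]

theorem t2Space_atlasTopology {src : ι → Set M} {φ : ∀ i, M → E i} {X : Type*}
    [TopologicalSpace X] [T2Space X] (hcover : ∀ x, ∃ i, x ∈ src i) {f : M → X}
    (hf : Function.Injective f)
    (h : ∀ i, IsOpen (φ i '' src i) ∧ ∃ g : E i → X, ContinuousOn g (φ i '' src i) ∧
      ∀ x ∈ src i, g (φ i x) = f x) : @T2Space M (atlasTopology src φ) := by
  let _ := atlasTopology src φ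
  refine T2Space.of_injective_continuous hf (continuous_def.2 fun O hO => ?_)
  choose hopen g hg hgf using h
  have hpreimage : f ⁻¹' O = ⋃ i, src i ∩ φ i ⁻¹' (φ i '' src i ∩ g i ⁻¹' O) := by
    ext x
    simp only [Set.mem_preimage, Set.mem_iUnion, Set.mem_inter_iff]
    constructor
    · intro hx
      obtain ⟨i, hi⟩ := hcover x
      exact ⟨i, hi, ⟨x, hi, rfl⟩, by rwa [hgf i x hi]⟩
    · rintro ⟨i, hi, -, hx⟩
      rwa [hgf i x hi] at hx
  rw [hpreimage]
  refine isOpen_iUnion fun i => TopologicalSpace.GenerateOpen.basic _ ⟨i, _, ?_, rfl⟩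
  exact (hg i).isOpen_inter_preimage (hopen i) hO

end Atlas

/-! ### The Cayley transform -/

section Cayley

open scoped Ring

section Ring

variable {R : Type*} [Ring R] {r x y : R}

/-- The Cayley transform `(1 - x) (1 + x)⁻¹`. It exchanges skew-adjoint and unitary elements and is
its own inverse; it is only meaningful if `1 + x` is invertible. -/
def cayley (x : R) : R := (1 - x) * (1 + x)⁻¹ʳ

theorem cayley_mul_one_add (hx : IsUnit (1 + x)) : cayley x * (1 + x) = 1 - x := by
  rw [cayley, Ring.inverse_mul_cancel_right _ _ hx]

theorem one_add_cayley (hx : IsUnit (1 + x)) : 1 + cayley x = 2 * (1 + x)⁻¹ʳ := by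
  apply hx.mul_right_cancel
  rw [add_mul, cayley_mul_one_add hx, Ring.inverse_mul_cancel_right _ _ hx, one_mul,
    add_add_sub_cancel, one_add_one_eq_two]

theorem isUnit_one_add_cayley (h2 : IsUnit (2 : R)) (hx : IsUnit (1 + x)) :
    IsUnit (1 + cayley x) := by
  rw [one_add_cayley hx]
  exact h2.mul hx.ringInverse

theorem cayley_cayley (h2 : IsUnit (2 : R)) (hx : IsUnit (1 + x)) : cayley (cayley x) = x := by
  apply (isUnit_one_add_cayley h2 hx).mul_right_cancel
  rw [cayley_mul_one_add (isUnit_one_add_cayley h2 hx)]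
  apply hx.mul_right_cancel
  rw [sub_mul, mul_assoc, add_mul, cayley_mul_one_add hx]
  noncomm_ring

theorem one_add_mul_cayley (hx : IsUnit (1 + x)) : (1 + x) * cayley x = 1 - x := by
  apply hx.mul_right_cancel
  rw [mul_assoc, cayley_mul_one_add hx]
  noncomm_ring

theorem cayley_neg_mul_cayley (hx : IsUnit (1 + x)) (hx' : IsUnit (1 - x)) :
    cayley (-x) * cayley x = 1 := by
  have hcancel : cayley (-x) * (1 - x) = 1 + x := by
    simpa only [← sub_eq_add_neg, sub_neg_eq_add] using
      cayley_mul_one_add (x := -x) (by rwa [← sub_eq_add_neg])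
  apply hx.mul_right_cancel
  rw [mul_assoc, cayley_mul_one_add hx, hcancel, one_mul]

theorem cayley_units_inv (u : Rˣ) (hu : IsUnit (1 + (u : R))) :
    cayley ((u⁻¹ : Rˣ) : R) = -cayley (u : R) := by
  have hinv : 1 + ((u⁻¹ : Rˣ) : R) = (1 + u) * (u⁻¹ : Rˣ) := by
    rw [add_mul, one_mul, Units.mul_inv, add_comm]
  have hu' : IsUnit (1 + ((u⁻¹ : Rˣ) : R)) := hinv ▸ hu.mul (u⁻¹).isUnit
  apply hu'.mul_right_cancel
  rw [cayley_mul_one_add hu', hinv, neg_mul, ← mul_assoc, cayley_mul_one_add hu, sub_mul, one_mul,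
    Units.mul_inv, neg_sub]

theorem mul_cayley_of_anticommute (hx : IsUnit (1 + x)) (hx' : IsUnit (1 - x))
    (h : r * x = -(x * r)) : r * cayley x = cayley (-x) * r := by
  apply hx.mul_right_cancel
  have hr : r * (1 + x) = (1 - x) * r := by rw [mul_add, h]; noncomm_ring
  have hr' : r * (1 - x) = (1 + x) * r := by rw [mul_sub, h]; noncomm_ring
  rw [mul_assoc, cayley_mul_one_add hx, mul_assoc, hr, hr', ← mul_assoc, sub_eq_add_neg 1 x,
    cayley_mul_one_add (by rwa [← sub_eq_add_neg]), sub_neg_eq_add]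

theorem cayley_mul_self_eq (hx : IsUnit (1 + x)) (hy : IsUnit (1 + y))
    (h : y * (1 + x * x) = 2 * x) : cayley x * cayley x = cayley y := by
  have hadd : (1 + x) * (1 + x) = (1 + y) * (1 + x * x) := by rw [add_mul 1 y, h]; noncomm_ring
  have hsub : (1 - x) * (1 - x) = (1 - y) * (1 + x * x) := by rw [sub_mul 1 y, h]; noncomm_ring
  have hcomm : (1 - x) * (1 + x) = (1 + x) * (1 - x) := by noncomm_ring
  apply (hx.mul hx).mul_right_cancel
  calc cayley x * cayley x * ((1 + x) * (1 + x))
      = cayley x * (cayley x * (1 + x)) * (1 + x) := by simp only [mul_assoc]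
    _ = (1 - x) * (1 - x) := by
      rw [cayley_mul_one_add hx, mul_assoc, hcomm, ← mul_assoc, cayley_mul_one_add hx]
    _ = cayley y * ((1 + x) * (1 + x)) := by
      rw [hsub, hadd, ← mul_assoc, cayley_mul_one_add hy]

end Ring

section StarRing

variable {R : Type*} [Ring R] [StarRing R] {x u : R}

theorem star_cayley (hx : IsUnit (1 + x)) : star (cayley x) = cayley (star x) := by
  have hx' : IsUnit (1 + star x) := by simpa using hx.star
  apply hx'.mul_left_cancel
  rw [one_add_mul_cayley hx', ← star_one, ← star_add, ← star_mul, cayley_mul_one_add hx, star_sub]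

theorem cayley_mem_skewAdjoint (hu : u ∈ unitary R) (hu' : IsUnit (1 + u)) :
    cayley u ∈ skewAdjoint R := by
  rw [skewAdjoint.mem_iff, star_cayley hu']
  exact cayley_units_inv (Unitary.toUnits ⟨u, hu⟩) hu'

end StarRing

section CStarAlgebra

variable {A : Type*} [CStarAlgebra A] {s x p : A}

theorem isUnit_one_sub_of_mem_skewAdjoint (hs : s ∈ skewAdjoint A) : IsUnit (1 - s) := by
  have hsa : IsSelfAdjoint (Complex.I • s) := by
    rw [IsSelfAdjoint, star_smul, skewAdjoint.mem_iff.1 hs]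
    simp
  have hI : Complex.I ∉ spectrum ℂ (Complex.I • s) := fun h => by
    simpa using hsa.im_eq_zero_of_mem_spectrum h
  rw [spectrum.notMem_iff, Algebra.algebraMap_eq_smul_one, ← smul_sub] at hI
  simpa [Units.smul_def, smul_smul] using hI.smul (Units.mk0 (-Complex.I) (by simp))

theorem isUnit_one_add_of_mem_skewAdjoint (hs : s ∈ skewAdjoint A) : IsUnit (1 + s) := by
  simpa using isUnit_one_sub_of_mem_skewAdjoint (neg_mem hs)

theorem star_cayley_of_mem_skewAdjoint (hs : s ∈ skewAdjoint A) :
    star (cayley s) = cayley (-s) := by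
  rw [star_cayley (isUnit_one_add_of_mem_skewAdjoint hs), skewAdjoint.mem_iff.1 hs]

theorem cayley_mem_unitary (hs : s ∈ skewAdjoint A) : cayley s ∈ unitary A := by
  have hadd := isUnit_one_add_of_mem_skewAdjoint hs
  have hsub := isUnit_one_sub_of_mem_skewAdjoint hs
  rw [Unitary.mem_iff, star_cayley_of_mem_skewAdjoint hs]
  refine ⟨cayley_neg_mul_cayley hadd hsub, ?_⟩
  simpa using cayley_neg_mul_cayley (x := -s) (by simpa [← sub_eq_add_neg]) (by simpa)

/-- For a projector `p` with range `W` and a skew-adjoint `s` which exchanges `W` and `W^⊥`, the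
projector onto `(1 + s) W`, that is onto the graph of `s : W → W^⊥`. -/
def tiltedProj (p s : A) : A := (1 + s) * p * (1 + s)⁻¹ʳ

theorem tiltedProj_eq (hs : s ∈ skewAdjoint A) (hps : p * s + s * p = s) :
    tiltedProj p s = p + s * ((2 * p - 1) * (1 + s)⁻¹ʳ) := by
  have hunit := isUnit_one_add_of_mem_skewAdjoint hs
  rw [tiltedProj, eq_comm, Ring.eq_mul_inverse_iff_mul_eq _ _ _ hunit, add_mul, mul_assoc s,
    Ring.inverse_mul_cancel_right _ _ hunit]
  rw [← sub_eq_zero, ← sub_eq_zero.2 hps]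
  noncomm_ring

theorem tiltedProj_mul_one_add (hs : s ∈ skewAdjoint A) :
    tiltedProj p s * (1 + s) = (1 + s) * p :=
  Ring.inverse_mul_cancel_right _ _ (isUnit_one_add_of_mem_skewAdjoint hs)

theorem two_mul_tiltedProj_sub_one (hs : s ∈ skewAdjoint A) (hps : p * s + s * p = s) :
    2 * tiltedProj p s - 1 = (2 * p - 1) * cayley s := by
  have hunit := isUnit_one_add_of_mem_skewAdjoint hs
  apply hunit.mul_right_cancel
  rw [sub_mul, mul_assoc, tiltedProj_mul_one_add hs, mul_assoc, cayley_mul_one_add hunit]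
  calc 2 * ((1 + s) * p) - 1 * (1 + s)
      = (2 * p - 1) * (1 - s) + 2 * (p * s + s * p - s) := by noncomm_ring
    _ = (2 * p - 1) * (1 - s) := by rw [hps, sub_self, mul_zero, add_zero]

theorem isUnit_two : IsUnit (2 : A) := by
  have h := (IsUnit.mk0 (2 : ℂ) two_ne_zero).map (algebraMap ℂ A)
  rwa [map_ofNat] at h

theorem reflection_mul_cayley (hs : s ∈ skewAdjoint A) (hps : p * s + s * p = s) :
    (2 * p - 1) * cayley s = cayley (-s) * (2 * p - 1) := by
  refine mul_cayley_of_anticommute (isUnit_one_add_of_mem_skewAdjoint hs)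
    (isUnit_one_sub_of_mem_skewAdjoint hs) ?_
  calc (2 * p - 1) * s = -(s * (2 * p - 1)) + 2 * (p * s + s * p - s) := by noncomm_ring
    _ = -(s * (2 * p - 1)) := by rw [hps, sub_self, mul_zero, add_zero]

theorem isStarProjection_tiltedProj (hp : IsStarProjection p) (hs : s ∈ skewAdjoint A)
    (hps : p * s + s * p = s) : IsStarProjection (tiltedProj p s) := by
  constructor
  · rw [IsIdempotentElem]
    nth_rw 2 [tiltedProj]
    rw [← mul_assoc, ← mul_assoc, tiltedProj_mul_one_add hs, mul_assoc (1 + s),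
      hp.isIdempotentElem.eq, tiltedProj]
  · have hp' : star (2 * p - 1) = 2 * p - 1 := by
      rw [star_sub, star_mul, hp.isSelfAdjoint.star_eq, star_one, star_ofNat, mul_two, two_mul]
    have hstar : star (2 * tiltedProj p s - 1) = 2 * tiltedProj p s - 1 := by
      rw [two_mul_tiltedProj_sub_one hs hps, star_mul, star_cayley_of_mem_skewAdjoint hs, hp',
        reflection_mul_cayley hs hps]
    rw [star_sub, star_one, star_mul, star_ofNat, mul_two, ← two_mul] at hstar
    exact isUnit_two.mul_left_cancel (sub_left_injective hstar)

/-- Half-angle formula: if `x = tan θ` and `s = tan (2 θ)`, then the unitary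
`cayley (-x) = exp (2 θ)` moves the range of `p` to the graph of `s`. -/
theorem cayley_neg_mul_eq_tiltedProj_mul (hx : x ∈ skewAdjoint A) (hs : s ∈ skewAdjoint A)
    (hpx : p * x + x * p = x) (hps : p * s + s * p = s) (h : s * (1 + x * x) = 2 * x) :
    cayley (-x) * p = tiltedProj p s * cayley (-x) := by
  have hadd := isUnit_one_add_of_mem_skewAdjoint hx
  have hinv : cayley x * cayley (-x) = 1 := by
    simpa using cayley_neg_mul_cayley (x := -x) (isUnit_one_add_of_mem_skewAdjoint (neg_mem hx))
      (isUnit_one_sub_of_mem_skewAdjoint (neg_mem hx))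
  have hrefl : (2 * tiltedProj p s - 1) * cayley (-x) = cayley (-x) * (2 * p - 1) := by
    calc (2 * tiltedProj p s - 1) * cayley (-x)
        = (2 * p - 1) * cayley x * (cayley x * cayley (-x)) := by
          rw [two_mul_tiltedProj_sub_one hs hps,
            ← cayley_mul_self_eq hadd (isUnit_one_add_of_mem_skewAdjoint hs) h]
          simp only [mul_assoc]
      _ = cayley (-x) * (2 * p - 1) := by rw [hinv, mul_one, reflection_mul_cayley hx hpx]
  apply isUnit_two.mul_left_cancel
  calc 2 * (cayley (-x) * p) = cayley (-x) * (2 * p - 1) + cayley (-x) := by noncomm_ring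
    _ = 2 * (tiltedProj p s * cayley (-x)) := by rw [← hrefl]; noncomm_ring

end CStarAlgebra

end Cayley

/-! ### Graphs of Hilbert-Schmidt operators -/

section Graph

open HilbertSchmidt
open scoped Ring

variable {H : Type*} [NormedAddCommGroup H] [InnerProductSpace ℂ H]

/-- The parametrization `w ↦ w + T w` of the graph of `T : U → U^⊥`. -/
def graphMap (U : Submodule ℂ H) (T : U →L[ℂ] Uᗮ) : U →L[ℂ] H :=
  U.subtypeL + Uᗮ.subtypeL ∘L T

section

variable {U : Submodule ℂ H} [CompleteSpace U]

theorem orthogonalProjectionOnto_comp_graphMap (T : U →L[ℂ] Uᗮ) :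
    U.orthogonalProjectionOnto ∘L graphMap U T = ContinuousLinearMap.id ℂ U := by
  ext x
  have hT : U.starProjection (T x : H) = 0 :=
    (Submodule.starProjection_apply_eq_zero_iff U).2 (T x).2
  simp [graphMap, hT]

theorem orthogonalProjectionOnto_orthogonal_comp_graphMap [CompleteSpace H] (T : U →L[ℂ] Uᗮ) :
    Uᗮ.orthogonalProjectionOnto ∘L graphMap U T = T := by
  ext x
  simp [graphMap]

end

variable [CompleteSpace H] (U : Submodule ℂ H) [CompleteSpace U]

/-- A Hilbert-Schmidt operator `U → U^⊥`, extended by zero to the whole space. -/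
def extendHS : HilbertSchmidt U Uᗮ →L[ℂ] HilbertSchmidt H H :=
  (compRight (E := H) (F := U) (G := H)).flip U.orthogonalProjectionOnto ∘L
    compLeft Uᗮ.subtypeL

/-- The compression of a Hilbert-Schmidt operator to an operator `U → U^⊥`. -/
def compressHS : HilbertSchmidt H H →L[ℂ] HilbertSchmidt U Uᗮ :=
  (compRight (E := U) (F := H) (G := Uᗮ)).flip U.subtypeL ∘L compLeft Uᗮ.orthogonalProjectionOnto

/-- The skew-adjoint operator on `H = U ⊕ U^⊥` with the blocks `T : U → U^⊥` and
`-T* : U^⊥ → U`. -/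
def skewExtension : HilbertSchmidt U Uᗮ →L[ℝ] HilbertSchmidt H H :=
  (extendHS U).restrictScalars ℝ -
    adjointₗᵢ.toContinuousLinearMap ∘L (extendHS U).restrictScalars ℝ

variable {U}
variable (T : HilbertSchmidt U Uᗮ)

theorem toCLM_skewExtension : toCLM H H (skewExtension U T) =
    toCLM H H (extendHS U T) - star (toCLM H H (extendHS U T)) := by
  simp [skewExtension, ContinuousLinearMap.star_eq_adjoint]

theorem skewExtension_mem_skewAdjoint :
    toCLM H H (skewExtension U T) ∈ skewAdjoint (H →L[ℂ] H) := by
  rw [skewAdjoint.mem_iff, toCLM_skewExtension, star_sub, star_star, neg_sub]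

theorem extendHS_mul_starProjection :
    toCLM H H (extendHS U T) * U.starProjection = toCLM H H (extendHS U T) := by
  ext x
  have h : U.orthogonalProjectionOnto (U.starProjection x) = U.orthogonalProjectionOnto x := by
    rw [Submodule.starProjection_apply, Submodule.orthogonalProjectionOnto_mem_subspace_eq_self]
  simp [extendHS, h]

theorem starProjection_mul_extendHS : U.starProjection * toCLM H H (extendHS U T) = 0 := by
  ext x
  exact (Submodule.starProjection_apply_eq_zero_iff U).2 (Subtype.mem _)

theorem starProjection_mul_star_extendHS :
    U.starProjection * star (toCLM H H (extendHS U T)) = star (toCLM H H (extendHS U T)) := by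
  have h := congrArg star (extendHS_mul_starProjection T)
  rwa [star_mul, (isSelfAdjoint_starProjection U).star_eq] at h

theorem star_extendHS_mul_starProjection :
    star (toCLM H H (extendHS U T)) * U.starProjection = 0 := by
  have h := congrArg star (starProjection_mul_extendHS T)
  rwa [star_mul, (isSelfAdjoint_starProjection U).star_eq, star_zero] at h

theorem starProjection_mul_skewExtension_add :
    U.starProjection * toCLM H H (skewExtension U T) +
      toCLM H H (skewExtension U T) * U.starProjection = toCLM H H (skewExtension U T) := by
  rw [toCLM_skewExtension, mul_sub, sub_mul, extendHS_mul_starProjection,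
    starProjection_mul_extendHS, starProjection_mul_star_extendHS,
    star_extendHS_mul_starProjection]
  abel

theorem one_add_skewExtension_apply (x : U) :
    (1 + toCLM H H (skewExtension U T)) x = graphMap U (toCLM U Uᗮ T) x := by
  have hx : star (toCLM H H (extendHS U T)) x = 0 := by
    simpa using congr($(star_extendHS_mul_starProjection T) (x : H))
  have hx' : toCLM H H (extendHS U T) x = toCLM U Uᗮ T x := by simp [extendHS]
  simp [toCLM_skewExtension, hx, hx', graphMap]

theorem compressHS_skewExtension : compressHS U (skewExtension U T) = T := by
  apply toCLM_injective
  rw [← orthogonalProjectionOnto_orthogonal_comp_graphMap (toCLM U Uᗮ T)]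
  ext x
  have h := congrArg Uᗮ.orthogonalProjectionOnto (one_add_skewExtension_apply T x)
  simpa [compressHS] using congrArg Subtype.val h

theorem skewExtension_compressHS {Y : HilbertSchmidt H H}
    (hY : toCLM H H Y ∈ skewAdjoint (H →L[ℂ] H))
    (hUY : U.starProjection * toCLM H H Y + toCLM H H Y * U.starProjection = toCLM H H Y) :
    skewExtension U (compressHS U Y) = Y := by
  set P := U.starProjection with hP
  have hPY : (1 - P) * toCLM H H Y * P = toCLM H H Y * P := by
    have hPYP := congr($hUY * P)
    rw [add_mul, mul_assoc (toCLM H H Y), (Submodule.isIdempotentElem_starProjection U).eq,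
      add_eq_right] at hPYP
    rw [sub_mul, sub_mul, one_mul, hPYP, sub_zero]
  have hext : toCLM H H (extendHS U (compressHS U Y)) = toCLM H H Y * P := by
    rw [← hPY, hP, ← Submodule.starProjection_orthogonal']
    ext x
    simp [extendHS, compressHS]
  apply toCLM_injective
  rw [toCLM_skewExtension, hext, star_mul, skewAdjoint.mem_iff.1 hY,
    (isSelfAdjoint_starProjection U).star_eq, mul_neg, sub_neg_eq_add, add_comm, hUY]

variable (U) in
/-- The orthogonal projector onto the graph of `T : U → U^⊥`. -/
def graphProj : H →L[ℂ] H := tiltedProj U.starProjection (toCLM H H (skewExtension U T))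

theorem isStarProjection_graphProj : IsStarProjection (graphProj U T) :=
  isStarProjection_tiltedProj isStarProjection_starProjection (skewExtension_mem_skewAdjoint T)
    (starProjection_mul_skewExtension_add T)

variable (U) in
/-- The difference of the orthogonal projectors onto the graph of `T` and onto `U`, as a
Hilbert-Schmidt operator. -/
def graphDiff : HilbertSchmidt H H :=
  compRight (skewExtension U T)
    ((2 * U.starProjection - 1) * (1 + toCLM H H (skewExtension U T))⁻¹ʳ)

theorem graphProj_eq : graphProj U T = U.starProjection + toCLM H H (graphDiff U T) := by
  rw [graphProj, tiltedProj_eq (skewExtension_mem_skewAdjoint T)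
    (starProjection_mul_skewExtension_add T), graphDiff, toCLM_compRight]
  rfl

theorem range_graphProj : (graphProj U T).range = (graphMap U (toCLM U Uᗮ T)).range := by
  ext y
  constructor
  · rintro ⟨x, rfl⟩
    exact ⟨U.orthogonalProjectionOnto ((1 + toCLM H H (skewExtension U T))⁻¹ʳ x),
      (one_add_skewExtension_apply T _).symm⟩
  · rintro ⟨x, rfl⟩
    refine ⟨(1 + toCLM H H (skewExtension U T)) x, ?_⟩
    have h := congr($(tiltedProj_mul_one_add (p := U.starProjection)
      (skewExtension_mem_skewAdjoint T)) (x : H))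
    change graphProj U T _ = (1 + toCLM H H (skewExtension U T)) (U.starProjection x) at h
    rwa [Submodule.starProjection_mem_subspace_eq_self, one_add_skewExtension_apply T x] at h

end Graph

section GraphCharts

open HilbertSchmidt

variable {H : Type*} [NormedAddCommGroup H] [InnerProductSpace ℂ H] [CompleteSpace H]

omit [CompleteSpace H] in
theorem isInvertible_orthogonalProjectionOnto_comp_subtypeL_iff {V W : Submodule ℂ H}
    [CompleteSpace V] [CompleteSpace W] :
    (W.orthogonalProjectionOnto ∘L V.subtypeL).IsInvertible ↔ IsCompl V Wᗮ := by
  set Q := W.orthogonalProjectionOnto ∘L V.subtypeL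
  have hker (x : V) : Q x = 0 ↔ (x : H) ∈ Wᗮ := by
    rw [← Submodule.orthogonalProjectionOnto_eq_zero_iff]
    rfl
  constructor
  · intro hinv
    refine IsCompl.of_eq ((Submodule.eq_bot_iff _).2 ?_) (Submodule.eq_top_iff'.2 fun x => ?_)
    · rintro x ⟨hx, hx'⟩
      exact congrArg Subtype.val
        (hinv.injective (((hker ⟨x, hx⟩).2 hx').trans (map_zero Q).symm))
    · obtain ⟨v, hv⟩ := hinv.surjective (W.orthogonalProjectionOnto x)
      refine Submodule.mem_sup.2 ⟨v, v.2, x - v, ?_, add_sub_cancel _ _⟩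
      rw [← Submodule.orthogonalProjectionOnto_eq_zero_iff, map_sub, ← hv]
      exact sub_self _
  · intro h
    have hinj : Q.ker = ⊥ := (Submodule.eq_bot_iff _).2 fun x hx =>
      Subtype.ext (Submodule.disjoint_def.1 h.disjoint _ x.2 ((hker x).1 hx))
    have hsurj : Q.range = ⊤ := Submodule.eq_top_iff'.2 fun y => by
      have hy : (y : H) ∈ V ⊔ Wᗮ := h.sup_eq_top.symm ▸ Submodule.mem_top
      obtain ⟨v, hv, z, hz, hvz⟩ := Submodule.mem_sup.1 hy
      refine ⟨⟨v, hv⟩, ?_⟩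
      change W.orthogonalProjectionOnto v = y
      rw [eq_sub_of_add_eq hvz, map_sub, Submodule.orthogonalProjectionOnto_eq_zero_iff.2 hz,
        sub_zero, Submodule.orthogonalProjectionOnto_mem_subspace_eq_self]
    exact ⟨ContinuousLinearEquiv.ofBijective Q hinj hsurj, rfl⟩

variable {Hp : Submodule ℂ H} [CompleteSpace Hp]

namespace ResGr

omit [CompleteSpace H] in
theorem mem_chartDomain_iff {W V : ResGr Hp} : V ∈ chartDomain W ↔
    ((space W).orthogonalProjectionOnto ∘L (space V).subtypeL).IsInvertible :=
  isInvertible_orthogonalProjectionOnto_comp_subtypeL_iff.symm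

theorem isHilbertSchmidt_orthogonalProjectionOnto_comp_subtypeL (W V : ResGr Hp) :
    IsHilbertSchmidt ((space W)ᗮ.orthogonalProjectionOnto ∘L (space V).subtypeL) := by
  convert ((isHilbertSchmidt_sub V W).comp_left
    (space W)ᗮ.orthogonalProjectionOnto).comp_right (space V).subtypeL using 1
  rw [← starProjection_space V, ← starProjection_space W]
  ext x
  simp [-starProjection_space, Submodule.starProjection_eq_self_iff.2
    (Submodule.starProjection_apply_mem (space W) (x : H))]

theorem isHilbertSchmidt_chartOp (W V : ResGr Hp) : IsHilbertSchmidt (chartOp W V) :=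
  (isHilbertSchmidt_orthogonalProjectionOnto_comp_subtypeL W V).comp_right _

@[simp]
theorem toCLM_chart (W V : ResGr Hp) : toCLM _ _ (chart W V) = chartOp W V :=
  toCLM_ofCLM (isHilbertSchmidt_chartOp W V)

variable (W : ResGr Hp) (T : HilbertSchmidt (space W) (space W)ᗮ)

/-- The graph of a Hilbert-Schmidt operator `W → W^⊥`, as a point of the Grassmannian. -/
def ofGraph : ResGr Hp :=
  ⟨graphProj (space W) T, mem_resGr_iff.2 ⟨isStarProjection_graphProj T, by
    rw [graphProj_eq, starProjection_space, add_sub_right_comm]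
    exact (isHilbertSchmidt_sub_base W).add (graphDiff (space W) T).isHilbertSchmidt⟩⟩

theorem coe_ofGraph : (ofGraph W T : H →L[ℂ] H) = graphProj (space W) T := rfl

theorem space_ofGraph : space (ofGraph W T) = (graphMap (space W) (toCLM _ _ T)).range :=
  range_graphProj T

/-- The isomorphism `w ↦ w + T w` of `W` with the graph of `T`. -/
def graphEquiv : space W ≃L[ℂ] space (ofGraph W T) :=
  ContinuousLinearEquiv.equivOfInverse
    ((graphMap (space W) (toCLM _ _ T)).codRestrict _ fun x => space_ofGraph W T ▸ ⟨x, rfl⟩)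
    ((space W).orthogonalProjectionOnto ∘L (space (ofGraph W T)).subtypeL)
    (fun x => congr($(orthogonalProjectionOnto_comp_graphMap (toCLM _ _ T)) x))
    (by
      rintro ⟨y, hy⟩
      rw [space_ofGraph] at hy
      obtain ⟨x, rfl⟩ := hy
      exact Subtype.ext (congrArg (graphMap (space W) (toCLM _ _ T))
        congr($(orthogonalProjectionOnto_comp_graphMap (toCLM _ _ T)) x)))

theorem subtypeL_comp_graphEquiv : (space (ofGraph W T)).subtypeL ∘L
    (graphEquiv W T : space W →L[ℂ] space (ofGraph W T)) = graphMap (space W) (toCLM _ _ T) :=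
  rfl

theorem ofGraph_mem_chartDomain_iff (W' : ResGr Hp) : ofGraph W T ∈ chartDomain W' ↔
    ((space W').orthogonalProjectionOnto ∘L graphMap (space W) (toCLM _ _ T)).IsInvertible := by
  rw [mem_chartDomain_iff, ← subtypeL_comp_graphEquiv, ← ContinuousLinearMap.comp_assoc,
    ContinuousLinearMap.isInvertible_comp_equiv]

theorem chartOp_ofGraph (W' : ResGr Hp) : chartOp W' (ofGraph W T) =
    ((space W')ᗮ.orthogonalProjectionOnto ∘L graphMap (space W) (toCLM _ _ T)) ∘L
      ContinuousLinearMap.inverse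
        ((space W').orthogonalProjectionOnto ∘L graphMap (space W) (toCLM _ _ T)) := by
  rw [← subtypeL_comp_graphEquiv, ← ContinuousLinearMap.comp_assoc,
    ← ContinuousLinearMap.comp_assoc, ContinuousLinearMap.inverse_comp_equiv, chartOp]
  ext x
  simp

theorem ofGraph_mem_chartDomain : ofGraph W T ∈ chartDomain W := by
  rw [ofGraph_mem_chartDomain_iff, orthogonalProjectionOnto_comp_graphMap]
  exact ⟨ContinuousLinearEquiv.refl ℂ _, rfl⟩

@[simp]
theorem chart_ofGraph : chart W (ofGraph W T) = T := by
  apply toCLM_injective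
  rw [toCLM_chart, chartOp_ofGraph, orthogonalProjectionOnto_comp_graphMap,
    orthogonalProjectionOnto_orthogonal_comp_graphMap, ContinuousLinearMap.inverse_id,
    ContinuousLinearMap.comp_id]

variable {W}

theorem ofGraph_chart {V : ResGr Hp} (hV : V ∈ chartDomain W) : ofGraph W (chart W V) = V := by
  set Q := (space W).orthogonalProjectionOnto ∘L (space V).subtypeL
  have hinv : Q.IsInvertible := mem_chartDomain_iff.1 hV
  have hgraph : ∀ v, graphMap (space W) (chartOp W V) (Q v) = v := by
    intro v
    have hchart : chartOp W V (Q v) = (space W)ᗮ.orthogonalProjectionOnto v :=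
      congrArg (fun z : space V => (space W)ᗮ.orthogonalProjectionOnto (z : H))
        (hinv.inverse_apply_self v)
    change (Q v : H) + (chartOp W V (Q v) : H) = v
    rw [hchart]
    exact (space W).starProjection_add_starProjection_orthogonal (v : H)
  apply space_injective
  rw [space_ofGraph, toCLM_chart]
  ext x
  constructor
  · rintro ⟨w, rfl⟩
    obtain ⟨v, rfl⟩ := hinv.surjective w
    exact (hgraph v).symm ▸ v.2
  · exact fun hx => ⟨Q ⟨x, hx⟩, hgraph ⟨x, hx⟩⟩

theorem chart_image (S : Set (ResGr Hp)) :
    chart W '' (chartDomain W ∩ S) = ofGraph W ⁻¹' S := by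
  ext T
  constructor
  · rintro ⟨V, ⟨hV, hS⟩, rfl⟩
    rwa [Set.mem_preimage, ofGraph_chart hV]
  · exact fun hT => ⟨ofGraph W T, ⟨ofGraph_mem_chartDomain W T, hT⟩, chart_ofGraph W T⟩

theorem chart_image_of_subset {S : Set (ResGr Hp)} (hS : S ⊆ chartDomain W) :
    chart W '' S = ofGraph W ⁻¹' S := by
  rw [← chart_image, Set.inter_eq_right.2 hS]

theorem chart_image_chartDomain : chart W '' chartDomain W = Set.univ :=
  (chart_image_of_subset subset_rfl).trans
    (Set.eq_univ_of_forall fun T => ofGraph_mem_chartDomain W T)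

theorem chart_injOn (W : ResGr Hp) : Set.InjOn (chart W) (chartDomain W) :=
  fun V hV V' hV' h => by rw [← ofGraph_chart hV, h, ofGraph_chart hV']

omit [CompleteSpace H] in
theorem base_mem_chartDomain (W : ResGr Hp) : W ∈ chartDomain W :=
  Submodule.isCompl_orthogonal (space W)

variable (W) (W' : ResGr Hp)

/-- The block `W → W'^⊥` of the parametrization of the graph of `T : W → W^⊥`. -/
def offBlock : HilbertSchmidt (space W) (space W')ᗮ :=
  mk _ (isHilbertSchmidt_orthogonalProjectionOnto_comp_subtypeL W' W) +
    compLeft ((space W')ᗮ.orthogonalProjectionOnto ∘L (space W)ᗮ.subtypeL) T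

theorem toCLM_offBlock : toCLM _ _ (offBlock W T W') =
    (space W')ᗮ.orthogonalProjectionOnto ∘L graphMap (space W) (toCLM _ _ T) := by
  rw [offBlock, map_add, toCLM_mk, toCLM_compLeft, graphMap, ContinuousLinearMap.comp_add,
    ContinuousLinearMap.comp_assoc]

theorem chart_ofGraph_eq : chart W' (ofGraph W T) =
    compRight (offBlock W T W') (ContinuousLinearMap.inverse
      ((space W').orthogonalProjectionOnto ∘L graphMap (space W) (toCLM _ _ T))) := by
  apply toCLM_injective
  rw [toCLM_chart, chartOp_ofGraph, toCLM_compRight, toCLM_offBlock]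

end ResGr

end GraphCharts

/-! ### Smoothness and the atlas of the Grassmannian -/

section RestrictScalars

variable {X Y Z V : Type*} [NormedAddCommGroup X] [NormedSpace ℂ X] [NormedSpace ℝ X]
  [IsScalarTower ℝ ℂ X] [NormedAddCommGroup Y] [NormedSpace ℂ Y] [NormedSpace ℝ Y]
  [IsScalarTower ℝ ℂ Y] [NormedAddCommGroup V] [NormedSpace ℝ V] {n : WithTop ℕ∞} {s : Set V}

theorem contDiffOn_complexCLM_apply (B : X →L[ℂ] Y) {f : V → X} (hf : ContDiffOn ℝ n f s) :
    ContDiffOn ℝ n (fun v => B (f v)) s :=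
  (B.contDiff.restrict_scalars ℝ).comp_contDiffOn hf

theorem contDiffOn_complexCLM_apply₂ [NormedAddCommGroup Z] [NormedSpace ℂ Z] [NormedSpace ℝ Z]
    [IsScalarTower ℝ ℂ Z] (B : X →L[ℂ] Y →L[ℂ] Z) {f : V → X} {g : V → Y}
    (hf : ContDiffOn ℝ n f s) (hg : ContDiffOn ℝ n g s) :
    ContDiffOn ℝ n (fun v => B (f v) (g v)) s :=
  (B.isBoundedBilinearMap.contDiff.restrict_scalars ℝ).comp_contDiffOn (hf.prodMk hg)

theorem contDiffOn_complexCLM_inverse {X Y : Type*} [NormedAddCommGroup X] [NormedSpace ℂ X]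
    [CompleteSpace X] [NormedAddCommGroup Y] [NormedSpace ℂ Y] {f : V → X →L[ℂ] Y}
    (hf : ContDiffOn ℝ n f s) (hu : ∀ v ∈ s, (f v).IsInvertible) :
    ContDiffOn ℝ n (fun v => (f v).inverse) s := by
  intro v hv
  obtain ⟨e, he⟩ := hu v hv
  have h := (contDiffAt_map_inverse (n := n) e).restrict_scalars ℝ
  rw [he] at h
  exact h.comp_contDiffWithinAt v (hf v hv)

theorem contDiffOn_ringInverse {R : Type*} [NormedRing R] [NormedAlgebra ℂ R] [CompleteSpace R]
    [NormedSpace ℝ R] [IsScalarTower ℝ ℂ R] {f : V → R} (hf : ContDiffOn ℝ n f s)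
    (hu : ∀ v ∈ s, IsUnit (f v)) : ContDiffOn ℝ n (fun v => Ring.inverse (f v)) s := by
  intro v hv
  obtain ⟨u, hu⟩ := hu v hv
  have h := (contDiffAt_ringInverse ℂ (n := n) u).restrict_scalars ℝ
  rw [hu] at h
  exact h.comp_contDiffWithinAt v (hf v hv)

end RestrictScalars

theorem contDiffOn_cayley {A V : Type*} [CStarAlgebra A] [NormedAddCommGroup V] [NormedSpace ℝ V]
    {n : WithTop ℕ∞} {s : Set V} {x : V → A} (hx : ContDiffOn ℝ n x s)
    (hunit : ∀ v ∈ s, IsUnit (1 + x v)) : ContDiffOn ℝ n (fun v => cayley (x v)) s :=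
  (contDiffOn_const.sub hx).mul (contDiffOn_ringInverse (contDiffOn_const.add hx) hunit)

section GraphSmooth

open HilbertSchmidt

variable {H : Type*} [NormedAddCommGroup H] [InnerProductSpace ℂ H] [CompleteSpace H]

section

variable (U : Submodule ℂ H) [CompleteSpace U] {n : WithTop ℕ∞}

theorem contDiff_toCLM_skewExtension : ContDiff ℝ n fun T => toCLM H H (skewExtension U T) := by
  rw [← contDiffOn_univ]
  exact contDiffOn_complexCLM_apply (toCLML H H) (skewExtension U).contDiff.contDiffOn

theorem contDiff_graphDiff : ContDiff ℝ n (graphDiff U) := by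
  rw [← contDiffOn_univ]
  refine contDiffOn_complexCLM_apply₂ compRight (skewExtension U).contDiff.contDiffOn
    (contDiffOn_const.mul (contDiffOn_ringInverse
      (contDiffOn_const.add (contDiff_toCLM_skewExtension U).contDiffOn) fun T _ => ?_))
  exact isUnit_one_add_of_mem_skewAdjoint (skewExtension_mem_skewAdjoint T)

theorem continuous_graphProj : Continuous (graphProj U) := by
  simp_rw [funext graphProj_eq]
  exact continuous_const.add
    ((toCLML H H).continuous.comp (contDiff_graphDiff U (n := 0)).continuous)

end

variable {Hp : Submodule ℂ H} [CompleteSpace Hp]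

namespace ResGr

theorem contDiff_orthogonalProjectionOnto_comp_graphMap (W W' : ResGr Hp) :
    ContDiff ℝ ∞ fun T : HilbertSchmidt (space W) (space W)ᗮ =>
      (space W').orthogonalProjectionOnto ∘L graphMap (space W) (toCLM _ _ T) := by
  have hlinear : ContDiffOn ℝ ∞ (fun T : HilbertSchmidt (space W) (space W)ᗮ =>
      graphMap (space W) (toCLM _ _ T)) Set.univ :=
    contDiffOn_const.add (contDiffOn_complexCLM_apply
      (ContinuousLinearMap.compL ℂ (space W) (space W)ᗮ H (space W)ᗮ.subtypeL ∘L toCLML _ _)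
      contDiffOn_id)
  rw [← contDiffOn_univ]
  exact contDiffOn_complexCLM_apply (ContinuousLinearMap.compL ℂ (space W) H (space W')
    (space W').orthogonalProjectionOnto) hlinear

theorem isOpen_ofGraph_preimage_chartDomain (W W' : ResGr Hp) :
    IsOpen (ofGraph W ⁻¹' chartDomain W') := by
  have h : ofGraph W ⁻¹' chartDomain W' = (fun T : HilbertSchmidt (space W) (space W)ᗮ =>
      (space W').orthogonalProjectionOnto ∘L graphMap (space W) (toCLM _ _ T)) ⁻¹'
      Set.range ((↑) : (space W ≃L[ℂ] space W') → space W →L[ℂ] space W') :=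
    Set.ext fun T => ofGraph_mem_chartDomain_iff W T W'
  rw [h]
  exact ContinuousLinearEquiv.isOpen.preimage
    (contDiff_orthogonalProjectionOnto_comp_graphMap W W').continuous

theorem contDiffOn_chart_ofGraph (W W' : ResGr Hp) :
    ContDiffOn ℝ ∞ (fun T => chart W' (ofGraph W T)) (ofGraph W ⁻¹' chartDomain W') := by
  have hoff : ContDiffOn ℝ ∞ (fun T => offBlock W T W') (ofGraph W ⁻¹' chartDomain W') :=
    contDiffOn_const.add (contDiffOn_complexCLM_apply _ contDiffOn_id)
  have hinv := contDiffOn_complexCLM_inverse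
    (contDiff_orthogonalProjectionOnto_comp_graphMap W W').contDiffOn
    fun T hT => (ofGraph_mem_chartDomain_iff W T W').1 hT
  exact (contDiffOn_complexCLM_apply₂ compRight hoff hinv).congr
    fun T _ => chart_ofGraph_eq W T W'

theorem isBanachManifoldAtlas : IsBanachManifoldAtlas (chartDomain (Hp := Hp)) chart where
  complete _ := inferInstance
  cover W := ⟨W, base_mem_chartDomain W⟩
  injOn := chart_injOn
  isOpen_image W W' := by
    rw [chart_image]
    exact isOpen_ofGraph_preimage_chartDomain W W'
  smooth_transition W W' := by
    refine ⟨fun T => chart W' (ofGraph W T), ?_, ?_⟩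
    · rw [chart_image]
      exact contDiffOn_chart_ofGraph W W'
    · exact fun V hV => congrArg (chart W') (ofGraph_chart hV.1)
  hausdorff := by
    refine t2Space_atlasTopology (fun W => ⟨W, base_mem_chartDomain W⟩)
      (f := fun V : ResGr Hp => (V : H →L[ℂ] H)) Subtype.val_injective fun W => ?_
    rw [chart_image_chartDomain]
    refine ⟨isOpen_univ, graphProj (space W), (continuous_graphProj _).continuousOn, ?_⟩
    intro V hV
    rw [← coe_ofGraph, ofGraph_chart hV]

end ResGr

end GraphSmooth

/-! ### Smooth rotations onto nearby graphs -/

section DoubleAngle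

open scoped Ring

/-- The double-angle function `tan θ ↦ tan (2 θ)`, with `1 + x * x` in place of `1 - tan² θ` because
it is applied to skew-adjoint `x`. Only meaningful if `1 + x * x` is invertible. -/
def tanTwoMul {R : Type*} [Ring R] (x : R) : R := x * (2 * (1 + x * x)⁻¹ʳ)

variable {R : Type*} [Ring R] {x p : R}

theorem tanTwoMul_mul (hx : IsUnit (1 + x * x)) : tanTwoMul x * (1 + x * x) = 2 * x := by
  rw [tanTwoMul, mul_assoc, mul_assoc, Ring.inverse_mul_cancel _ hx, mul_one, mul_two, two_mul]

theorem mul_tanTwoMul (hx : IsUnit (1 + x * x)) : (1 + x * x) * tanTwoMul x = 2 * x := by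
  have hcomm : (1 + x * x) * (x * 2) = (x * 2) * (1 + x * x) := by noncomm_ring
  rw [tanTwoMul, ← mul_assoc x, ← mul_assoc, hcomm, mul_assoc, Ring.mul_inverse_cancel _ hx,
    mul_one, mul_two, two_mul]

theorem tanTwoMul_mem_skewAdjoint [StarRing R] (hx : IsUnit (1 + x * x))
    (hskew : x ∈ skewAdjoint R) : tanTwoMul x ∈ skewAdjoint R := by
  have hstar : star x = -x := skewAdjoint.mem_iff.1 hskew
  apply skewAdjoint.mem_iff.2
  apply hx.mul_right_cancel
  calc star (tanTwoMul x) * (1 + x * x) = star ((1 + x * x) * tanTwoMul x) := by simp [hstar]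
    _ = -(tanTwoMul x * (1 + x * x)) := by
      rw [mul_tanTwoMul hx, tanTwoMul_mul hx, two_mul, star_add, hstar, neg_add]
    _ = -tanTwoMul x * (1 + x * x) := (neg_mul _ _).symm

theorem mul_tanTwoMul_add (hx : IsUnit (1 + x * x)) (hp : p * x + x * p = x) :
    p * tanTwoMul x + tanTwoMul x * p = tanTwoMul x := by
  have hcomm : p * (1 + x * x) = (1 + x * x) * p := by
    calc p * (1 + x * x) = (1 + x * x) * p + ((p * x + x * p) * x - x * (p * x + x * p)) := by
          noncomm_ring
      _ = (1 + x * x) * p := by rw [hp, sub_self, add_zero]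
  apply hx.mul_right_cancel
  calc (p * tanTwoMul x + tanTwoMul x * p) * (1 + x * x)
      = p * (tanTwoMul x * (1 + x * x)) + tanTwoMul x * (1 + x * x) * p := by
        rw [add_mul, mul_assoc, mul_assoc _ p, hcomm, ← mul_assoc (tanTwoMul x)]
    _ = 2 * (p * x + x * p) := by rw [tanTwoMul_mul hx]; noncomm_ring
    _ = tanTwoMul x * (1 + x * x) := by rw [hp, tanTwoMul_mul hx]

end DoubleAngle

theorem exists_contDiffOn_rightInverse {𝕜 E F : Type*} [RCLike 𝕜] [NormedAddCommGroup E]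
    [NormedSpace 𝕜 E] [CompleteSpace E] [NormedAddCommGroup F] [NormedSpace 𝕜 F] {f : E → F}
    {f' : E ≃L[𝕜] F} {a : E} {s : Set E} (hs : s ∈ nhds a) (hf : ContDiffAt 𝕜 ω f a)
    (hf' : HasFDerivAt f (f' : E →L[𝕜] F) a) :
    ∃ (g : F → E) (O : Set F), IsOpen O ∧ f a ∈ O ∧ ContDiffOn 𝕜 ω g O ∧
      ∀ y ∈ O, g y ∈ s ∧ f (g y) = y := by
  have hg := hf.to_localInverse hf' (by simp)
  have hgs : ∀ᶠ y in nhds (f a), hf.localInverse hf' (by simp) y ∈ s :=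
    hg.continuousAt.preimage_mem_nhds (by rwa [hf.localInverse_apply_image hf'])
  have hinv : ∀ᶠ y in nhds (f a), f (hf.localInverse hf' (by simp) y) = y :=
    (hf.hasStrictFDerivAt' hf' (by simp)).eventually_right_inverse
  obtain ⟨O, hO, hopen, hmem⟩ := eventually_nhds_iff.1
    ((hg.eventually (by simp)).and (hgs.and hinv))
  exact ⟨_, O, hopen, hmem, fun y hy => (hO y hy).1.contDiffWithinAt, fun y hy => (hO y hy).2⟩

section Rotation

open HilbertSchmidt
open scoped Ring

variable {H : Type*} [NormedAddCommGroup H] [InnerProductSpace ℂ H] [CompleteSpace H]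
variable (U : Submodule ℂ H) [CompleteSpace U]

/-- The double-angle map on the blocks of skew-adjoint operators which exchange `U` and `U^⊥`. -/
def tanTwoMulHS (T : HilbertSchmidt U Uᗮ) : HilbertSchmidt U Uᗮ :=
  compressHS U (compRight (skewExtension U T)
    (2 * (1 + toCLM H H (skewExtension U T) * toCLM H H (skewExtension U T))⁻¹ʳ))

/-- The operators on which the double-angle map `tanTwoMulHS` is meaningful. -/
def tanTwoMulDomain : Set (HilbertSchmidt U Uᗮ) :=
  {T | IsUnit (1 + toCLM H H (skewExtension U T) * toCLM H H (skewExtension U T))}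

variable {U} in
theorem toCLM_skewExtension_tanTwoMulHS {T : HilbertSchmidt U Uᗮ} (hT : T ∈ tanTwoMulDomain U) :
    toCLM H H (skewExtension U (tanTwoMulHS U T)) = tanTwoMul (toCLM H H (skewExtension U T)) := by
  have hcomp : toCLM H H (compRight (skewExtension U T)
      (2 * (1 + toCLM H H (skewExtension U T) * toCLM H H (skewExtension U T))⁻¹ʳ)) =
        tanTwoMul (toCLM H H (skewExtension U T)) :=
    toCLM_compRight _ _
  rw [tanTwoMulHS, skewExtension_compressHS, hcomp]
  · rw [hcomp]
    exact tanTwoMul_mem_skewAdjoint hT (skewExtension_mem_skewAdjoint T)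
  · rw [hcomp]
    exact mul_tanTwoMul_add hT (starProjection_mul_skewExtension_add T)

theorem contDiff_one_add_skewExtension_mul_self {n : WithTop ℕ∞} : ContDiff ℝ n fun T =>
    1 + toCLM H H (skewExtension U T) * toCLM H H (skewExtension U T) :=
  contDiff_const.add ((contDiff_toCLM_skewExtension U).mul (contDiff_toCLM_skewExtension U))

theorem tanTwoMulDomain_mem_nhds_zero : tanTwoMulDomain U ∈ nhds 0 :=
  (Units.isOpen.preimage
    (contDiff_one_add_skewExtension_mul_self U (n := 0)).continuous).mem_nhds (by simp)

theorem contDiffOn_ringInverse_one_add_skewExtension_mul_self {n : WithTop ℕ∞} : ContDiffOn ℝ n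
    (fun T => 2 * (1 + toCLM H H (skewExtension U T) * toCLM H H (skewExtension U T))⁻¹ʳ)
    (tanTwoMulDomain U) :=
  contDiffOn_const.mul (contDiffOn_ringInverse
    (contDiff_one_add_skewExtension_mul_self U).contDiffOn fun _ hT => hT)

theorem contDiffOn_tanTwoMulHS {n : WithTop ℕ∞} :
    ContDiffOn ℝ n (tanTwoMulHS U) (tanTwoMulDomain U) :=
  contDiffOn_complexCLM_apply (compressHS U) (contDiffOn_complexCLM_apply₂ compRight
    (skewExtension U).contDiff.contDiffOn
    (contDiffOn_ringInverse_one_add_skewExtension_mul_self U))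

theorem hasFDerivAt_tanTwoMulHS_zero : HasFDerivAt (tanTwoMulHS U)
    ((ContinuousLinearEquiv.smulLeft (R₁ := ℝ) (Units.mk0 (2 : ℝ) two_ne_zero) :
      HilbertSchmidt U Uᗮ ≃L[ℝ] HilbertSchmidt U Uᗮ) :
        HilbertSchmidt U Uᗮ →L[ℝ] HilbertSchmidt U Uᗮ) 0 := by
  have hfactor : HasFDerivAt (fun T =>
      2 * (1 + toCLM H H (skewExtension U T) * toCLM H H (skewExtension U T))⁻¹ʳ) _ 0 :=
    (((contDiffOn_ringInverse_one_add_skewExtension_mul_self U (n := 1)).contDiffAt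
      (tanTwoMulDomain_mem_nhds_zero U)).differentiableAt one_ne_zero).hasFDerivAt
  have hbilinear := (((ContinuousLinearMap.compL ℂ _ _ _ (compressHS U)) ∘L
    compRight (E := H) (F := H) (G := H)).isBoundedBilinearMap.hasFDerivAt
      (skewExtension U 0, 2 * (1 + toCLM H H (skewExtension U 0) *
        toCLM H H (skewExtension U 0))⁻¹ʳ)).restrictScalars ℝ
  refine (hbilinear.comp 0 ((skewExtension U).hasFDerivAt.prodMk hfactor)).congr_fderiv ?_
  refine ContinuousLinearMap.ext fun T => ?_
  have htwo : compRight (skewExtension U T) (2 : H →L[ℂ] H) = (2 : ℝ) • skewExtension U T := by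
    apply toCLM_injective
    rw [toCLM_compRight, toCLM_real_smul, two_smul]
    exact mul_two _
  change compressHS U (compRight (skewExtension U 0) _) +
    compressHS U (compRight (skewExtension U T) (2 * (1 + toCLM H H (skewExtension U 0) *
      toCLM H H (skewExtension U 0))⁻¹ʳ)) = (2 : ℝ) • T
  rw [map_zero, map_zero, zero_apply, map_zero, zero_add, map_zero, mul_zero,
    add_zero, Ring.inverse_one, mul_one, htwo, two_smul, map_add, compressHS_skewExtension,
    two_smul]

theorem exists_contDiffOn_rotation : ∃ (ρ : HilbertSchmidt U Uᗮ → H →L[ℂ] H)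
    (O : Set (HilbertSchmidt U Uᗮ)), IsOpen O ∧ 0 ∈ O ∧ ContDiffOn ℝ ∞ ρ O ∧ ∀ T ∈ O,
      ρ T ∈ unitary (H →L[ℂ] H) ∧ ρ T * U.starProjection = graphProj U T * ρ T := by
  obtain ⟨g, O, hO, hmem, hg, hinv⟩ := exists_contDiffOn_rightInverse
    (tanTwoMulDomain_mem_nhds_zero U)
    ((contDiffOn_tanTwoMulHS U).contDiffAt (tanTwoMulDomain_mem_nhds_zero U))
    (hasFDerivAt_tanTwoMulHS_zero U)
  have hskew (T : HilbertSchmidt U Uᗮ) := skewExtension_mem_skewAdjoint (g T)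
  refine ⟨fun T => cayley (-toCLM H H (skewExtension U (g T))), O, hO, ?_, ?_, fun T hT => ?_⟩
  · simpa [tanTwoMulHS] using hmem
  · refine contDiffOn_cayley ?_ fun T _ => isUnit_one_add_of_mem_skewAdjoint (neg_mem (hskew T))
    exact ((contDiff_toCLM_skewExtension U).comp_contDiffOn (hg.of_le le_top)).neg
  · obtain ⟨hunit, hT'⟩ := hinv T hT
    have htan := toCLM_skewExtension_tanTwoMulHS hunit
    rw [hT'] at htan
    refine ⟨cayley_mem_unitary (neg_mem (hskew T)), cayley_neg_mul_eq_tiltedProj_mul (hskew T)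
      (skewExtension_mem_skewAdjoint T) (starProjection_mul_skewExtension_add _)
      (starProjection_mul_skewExtension_add T) ?_⟩
    rw [htan, tanTwoMul_mul hunit]

end Rotation

/-! ### Local sections of the restricted unitary group -/

section ResOp

variable {H : Type*} [NormedAddCommGroup H] [InnerProductSpace ℂ H] [CompleteSpace H]
variable (Hp : Submodule ℂ H) [CompleteSpace Hp]

omit [CompleteSpace H] in
theorem commProj_apply (X : H →L[ℂ] H) :
    commProj Hp X = X * Hp.starProjection - Hp.starProjection * X := rfl

omit [CompleteSpace H] in
theorem commProj_commProj_commProj (X : H →L[ℂ] H) :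
    commProj Hp (commProj Hp (commProj Hp X)) = commProj Hp X := by
  have hP : Hp.starProjection * Hp.starProjection = Hp.starProjection :=
    Hp.isIdempotentElem_starProjection.eq
  simp only [commProj_apply, sub_mul, mul_sub, mul_assoc, hP]
  simp only [← mul_assoc, hP]
  abel

/-- The commutator `X ↦ [X, P₊]` as a bounded map on bounded operators. -/
def commProjL : (H →L[ℂ] H) →L[ℂ] (H →L[ℂ] H) :=
  (ContinuousLinearMap.mul ℂ (H →L[ℂ] H)).flip Hp.starProjection -
    ContinuousLinearMap.mul ℂ (H →L[ℂ] H) Hp.starProjection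

/-- The commutator `K ↦ [K, P₊]` as a bounded map on Hilbert-Schmidt operators. -/
def commProjHS : HilbertSchmidt H H →L[ℂ] HilbertSchmidt H H :=
  HilbertSchmidt.compRight.flip Hp.starProjection - HilbertSchmidt.compLeft Hp.starProjection

theorem toCLM_commProjHS (K : HilbertSchmidt H H) :
    HilbertSchmidt.toCLM H H (commProjHS Hp K) = commProj Hp (HilbertSchmidt.toCLM H H K) := rfl

namespace ResOp

/-- The map `(X, K) ↦ X + [K - [X, P₊], P₊]` underlying `ResOp.ofPair`. -/
def ofPairCLM : (H →L[ℂ] H) × HilbertSchmidt H H →L[ℂ] (H →L[ℂ] H) :=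
  .fst ℂ _ _ + commProjL Hp ∘L
    (HilbertSchmidt.toCLML H H ∘L .snd ℂ _ _ - commProjL Hp ∘L .fst ℂ _ _)

-- `[·, P₊]` is equal to its third power, so the contribution of the arbitrary operator `X` cancels.
theorem commProj_ofPairCLM (x : (H →L[ℂ] H) × HilbertSchmidt H H) :
    commProj Hp (ofPairCLM Hp x) =
      HilbertSchmidt.toCLM H H (commProjHS Hp (commProjHS Hp x.2)) := by
  change commProj Hp (x.1 + commProj Hp (HilbertSchmidt.toCLM H H x.2 - commProj Hp x.1)) = _
  rw [map_add, map_sub, map_sub, commProj_commProj_commProj, add_sub_cancel, toCLM_commProjHS,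
    toCLM_commProjHS]

/-- A bounded left inverse of `ResOp.pair`, through which smoothness of maps into `ResOp Hp` is
checked on the two components of `ResOp.pair`. -/
def ofPair : (H →L[ℂ] H) × HilbertSchmidt H H →L[ℂ] ResOp Hp :=
  LinearMap.mkContinuous
    { toFun x := ⟨ofPairCLM Hp x, show IsHilbertSchmidt (commProj Hp _) by
        rw [commProj_ofPairCLM]
        exact HilbertSchmidt.isHilbertSchmidt _⟩
      map_add' x y := Subtype.ext (map_add (ofPairCLM Hp) x y)
      map_smul' c x := Subtype.ext (map_smul (ofPairCLM Hp) c x) }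
    ‖(ofPairCLM Hp).prod (commProjHS Hp ∘L commProjHS Hp ∘L .snd ℂ _ _)‖ fun x => by
      refine le_trans (le_of_eq ?_) (ContinuousLinearMap.le_opNorm _ x)
      change ‖pair Hp _‖ = _
      congr 1
      exact Prod.ext rfl (Subtype.ext (commProj_ofPairCLM Hp x))

theorem toCLM_ofPair {X : H →L[ℂ] H} {K : HilbertSchmidt H H}
    (h : HilbertSchmidt.toCLM H H K = commProj Hp X) : toCLM Hp (ofPair Hp (X, K)) = X := by
  change X + commProj Hp (HilbertSchmidt.toCLM H H K - commProj Hp X) = X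
  rw [h, sub_self, map_zero, add_zero]

theorem exists_contDiffOn_lift {E : Type*} [NormedAddCommGroup E] [NormedSpace ℝ E] {s : Set E}
    {n : WithTop ℕ∞} {X : E → H →L[ℂ] H} {K : E → HilbertSchmidt H H} (hX : ContDiffOn ℝ n X s)
    (hK : ContDiffOn ℝ n K s)
    (hXK : ∀ T ∈ s, HilbertSchmidt.toCLM H H (K T) = commProj Hp (X T)) :
    ∃ Γ : E → ResOp Hp, ContDiffOn ℝ n Γ s ∧ ∀ T ∈ s, toCLM Hp (Γ T) = X T :=
  ⟨fun T => ofPair Hp (X T, K T), contDiffOn_complexCLM_apply (ofPair Hp) (hX.prodMk hK),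
    fun T hT => toCLM_ofPair Hp (hXK T hT)⟩

/-- The inclusion into the bounded operators as a bounded map. -/
def toCLML : ResOp Hp →L[ℂ] (H →L[ℂ] H) :=
  (toCLM Hp).mkContinuous 1 fun X => by
    rw [one_mul]
    exact norm_fst_le (pair Hp X)

end ResOp

end ResOp

section LocalSections

open HilbertSchmidt

variable {H : Type*} [NormedAddCommGroup H] [InnerProductSpace ℂ H] [CompleteSpace H]

theorem map_eq_iff_mul_starProjection_eq {σ : H →L[ℂ] H} (hσ : σ ∈ unitary (H →L[ℂ] H))
    (U V : Submodule ℂ H) [CompleteSpace U] [CompleteSpace V] :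
    U.map σ.toLinearMap = V ↔ σ * U.starProjection = V.starProjection * σ := by
  let e : H ≃ₗᵢ[ℂ] H := Unitary.linearIsometryEquiv ⟨σ, hσ⟩
  have hproj : (U.map (e.toLinearEquiv : H →ₗ[ℂ] H)).starProjection =
      σ * U.starProjection * star σ :=
    ContinuousLinearMap.ext fun x => Submodule.starProjection_map_apply e U x
  change U.map (e.toLinearEquiv : H →ₗ[ℂ] H) = V ↔ _
  rw [← Submodule.starProjection_inj, hproj]
  constructor <;> intro h
  · rw [← h, mul_assoc, Unitary.star_mul_self_of_mem hσ, mul_one]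
  · rw [h, mul_assoc, Unitary.mul_star_self_of_mem hσ, mul_one]

omit [CompleteSpace H] in
theorem extendIsometry_mul_eq_zero {U V U' V' : Submodule ℂ H} [CompleteSpace U] [CompleteSpace U']
    (h : V' ≤ Uᗮ) (e : U ≃ₗᵢ[ℂ] V) (f : U' ≃ₗᵢ[ℂ] V') :
    extendIsometry e * extendIsometry f = 0 := by
  ext x
  change (e (U.orthogonalProjectionOnto (f _ : H)) : H) = 0
  rw [Submodule.orthogonalProjectionOnto_eq_zero_iff.2 (h (Subtype.mem _)), map_zero,
    ZeroMemClass.coe_zero]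

theorem extendIsometry_add_mem_unitary {U V : Submodule ℂ H} [CompleteSpace U] [CompleteSpace V]
    (e : U ≃ₗᵢ[ℂ] V) (f : Uᗮ ≃ₗᵢ[ℂ] Vᗮ) :
    extendIsometry e + extendIsometry f ∈ unitary (H →L[ℂ] H) := by
  have hU : U ≤ Uᗮᗮ := U.le_orthogonal_orthogonal
  have hV : V ≤ Vᗮᗮ := V.le_orthogonal_orthogonal
  rw [Unitary.mem_iff, star_add, add_mul, mul_add, mul_add, add_mul, mul_add, mul_add,
    star_extendIsometry_mul_self, star_extendIsometry_mul_self, extendIsometry_mul_star_self,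
    extendIsometry_mul_star_self, star_extendIsometry, star_extendIsometry,
    extendIsometry_mul_eq_zero le_rfl, extendIsometry_mul_eq_zero hV,
    extendIsometry_mul_eq_zero le_rfl, extendIsometry_mul_eq_zero hU, add_zero, add_zero, zero_add,
    zero_add, Submodule.starProjection_orthogonal', Submodule.starProjection_orthogonal',
    add_sub_cancel, add_sub_cancel]
  exact ⟨rfl, rfl⟩

theorem extendIsometry_add_mul_starProjection {U V : Submodule ℂ H} [CompleteSpace U]
    [CompleteSpace V] (e : U ≃ₗᵢ[ℂ] V) (f : Uᗮ ≃ₗᵢ[ℂ] Vᗮ) :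
    (extendIsometry e + extendIsometry f) * U.starProjection =
      V.starProjection * (extendIsometry e + extendIsometry f) := by
  calc (extendIsometry e + extendIsometry f) * U.starProjection
      = extendIsometry e * star (extendIsometry e) * extendIsometry e := by
        rw [add_mul, ← star_extendIsometry_mul_self e, ← mul_assoc, ← mul_assoc,
          star_extendIsometry, extendIsometry_mul_eq_zero U.le_orthogonal_orthogonal, zero_mul,
          add_zero]
    _ = V.starProjection * (extendIsometry e + extendIsometry f) := by
        rw [mul_add, ← extendIsometry_mul_star_self e, mul_assoc _ _ (extendIsometry f),
          star_extendIsometry, extendIsometry_mul_eq_zero le_rfl, mul_zero, add_zero]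

namespace ResGr

variable {Hp : Submodule ℂ H} [CompleteSpace Hp]

theorem exists_unitary [TopologicalSpace.SeparableSpace H]
    (hp : ¬ FiniteDimensional ℂ Hp) (hm : ¬ FiniteDimensional ℂ Hpᗮ) (W : ResGr Hp) :
    ∃ g ∈ unitary (H →L[ℂ] H), g * Hp.starProjection = W * g := by
  obtain ⟨e⟩ := nonempty_linearIsometryEquiv hp (not_finiteDimensional_space hp W)
  obtain ⟨f⟩ := nonempty_linearIsometryEquiv hm (not_finiteDimensional_space_orthogonal hm W)
  refine ⟨_, extendIsometry_add_mem_unitary e f, ?_⟩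
  rw [extendIsometry_add_mul_starProjection, starProjection_space]

theorem chart_self (W : ResGr Hp) : chart W W = 0 := by
  apply toCLM_injective
  rw [toCLM_chart, map_zero, chartOp,
    Submodule.orthogonalProjectionOnto_comp_subtypeL_eq_zero_iff.2
      (space W).isOrtho_orthogonal_left, ContinuousLinearMap.zero_comp]

theorem exists_contDiffOn_resUnitary [TopologicalSpace.SeparableSpace H]
    (hp : ¬ FiniteDimensional ℂ Hp) (hm : ¬ FiniteDimensional ℂ Hpᗮ) (W : ResGr Hp) :
    ∃ (Γ : HilbertSchmidt (space W) (space W)ᗮ → ResOp Hp)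
      (O : Set (HilbertSchmidt (space W) (space W)ᗮ)), IsOpen O ∧ 0 ∈ O ∧ ContDiffOn ℝ ∞ Γ O ∧
        ∀ T ∈ O, Γ T ∈ ResUnitary Hp ∧
          Hp.map (ResOp.toCLM Hp (Γ T)).toLinearMap = space (ofGraph W T) := by
  obtain ⟨g, hg, hgW⟩ := exists_unitary hp hm W
  obtain ⟨ρ, O, hO, hzero, hρ, hprop⟩ := exists_contDiffOn_rotation (space W)
  have hσ : ContDiffOn ℝ ∞ (fun T => ρ T * g) O := hρ.mul contDiffOn_const
  have hunit : ∀ T ∈ O, ρ T * g ∈ unitary (H →L[ℂ] H) := fun T hT => mul_mem (hprop T hT).1 hg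
  have hcomm : ∀ T ∈ O, ρ T * g * Hp.starProjection = ofGraph W T * (ρ T * g) := fun T hT => by
    rw [coe_ofGraph, ← mul_assoc, ← (hprop T hT).2, starProjection_space, mul_assoc, hgW,
      mul_assoc]
  let K (T : HilbertSchmidt (space W) (space W)ᗮ) : HilbertSchmidt H H :=
    compRight (mk _ (isHilbertSchmidt_sub_base W) + graphDiff (space W) T) (ρ T * g)
  have hK : ContDiffOn ℝ ∞ K O := contDiffOn_complexCLM_apply₂ compRight
    (contDiffOn_const.add (contDiff_graphDiff (space W)).contDiffOn) hσ
  have hKσ : ∀ T ∈ O, toCLM H H (K T) = commProj Hp (ρ T * g) := fun T hT => by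
    rw [commProj_apply, hcomm T hT, toCLM_compRight, map_add, toCLM_mk, ← sub_mul, coe_ofGraph,
      graphProj_eq, starProjection_space, add_sub_right_comm]
    rfl
  obtain ⟨Γ, hΓ, hΓσ⟩ := ResOp.exists_contDiffOn_lift Hp hσ hK hKσ
  refine ⟨Γ, O, hO, hzero, hΓ, fun T hT => ⟨?_, ?_⟩⟩
  · rw [ResUnitary, Set.mem_ofPred_eq, hΓσ T hT]
    exact hunit T hT
  · rw [hΓσ T hT, map_eq_iff_mul_starProjection_eq (hunit T hT), starProjection_space, hcomm T hT]

theorem exists_localSection [TopologicalSpace.SeparableSpace H]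
    (hp : ¬ FiniteDimensional ℂ Hp) (hm : ¬ FiniteDimensional ℂ Hpᗮ) (W : ResGr Hp) :
    ∃ β : LocalSection Hp, W ∈ β.dom := by
  obtain ⟨Γ, O, hO, hzero, hΓ, hprop⟩ := exists_contDiffOn_resUnitary hp hm W
  have hbase : W ∈ chartDomain W ∩ chart W ⁻¹' O :=
    ⟨base_mem_chartDomain W, by rwa [Set.mem_preimage, chart_self]⟩
  have himage : chart W '' (chartDomain W ∩ chart W ⁻¹' O) = O := by
    rw [chart_image]
    ext T
    simp
  exact ⟨
    { base := W
      dom := chartDomain W ∩ chart W ⁻¹' O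
      toFun := fun V => Γ (chart W V)
      base_mem := hbase
      dom_subset := Set.inter_subset_left
      isOpen_dom := by rwa [himage]
      mem_resUnitary := fun V hV => (hprop _ hV.2).1
      map_eq := fun V hV => by rw [(hprop _ hV.2).2, ofGraph_chart hV.1]
      smooth := ⟨Γ, by rwa [himage], fun V _ => rfl⟩ }, hbase⟩

end ResGr

end LocalSections

/-! ### Cayley charts of the unitary group -/

section SkewPart

variable {A : Type*} [NormedAddCommGroup A] [StarAddMonoid A] [NormedStarGroup A]
  [NormedSpace ℝ A] [StarModule ℝ A]

/-- The projection `x ↦ (x - x*) / 2` onto the skew-adjoint elements, as a bounded map. -/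
def skewPart : A →L[ℝ] skewAdjoint.submodule ℝ A :=
  LinearMap.mkContinuous (skewAdjointPart ℝ : A →ₗ[ℝ] skewAdjoint A) 1 fun x => by
    change ‖(⅟2 : ℝ) • (x - star x)‖ ≤ 1 * ‖x‖
    have hsub : ‖x - star x‖ ≤ ‖x‖ + ‖x‖ := by simpa only [norm_star] using norm_sub_le x (star x)
    rw [norm_smul, invOf_eq_inv, norm_inv, Real.norm_ofNat]
    linarith

theorem skewPart_of_mem_skewAdjoint {x : A} (hx : x ∈ skewAdjoint A) : skewPart x = ⟨x, hx⟩ :=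
  LinearMap.congr_fun (skewAdjointPart_comp_subtype_skewAdjoint ℝ) (⟨x, hx⟩ : skewAdjoint A)

instance [CompleteSpace A] : CompleteSpace (skewAdjoint.submodule ℝ A) :=
  (isClosed_eq continuous_star continuous_neg :
    IsClosed {x : A | star x = -x}).completeSpace_coe

end SkewPart

section CayleyChart

variable {K : Type*} [NormedAddCommGroup K] [InnerProductSpace ℂ K] [CompleteSpace K]

/-- The domain of the Cayley chart centred at the unitary operator `u₀`. -/
def cayleyChartDomain (u₀ : K →L[ℂ] K) : Set (K →L[ℂ] K) :=
  {u | IsUnit (1 + u * star u₀)} ∩ unitary (K →L[ℂ] K)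

/-- The Cayley transform of `u u₀*`. The skew-adjoint part only serves to get a total map into the
skew-adjoint operators, see `coe_cayleyCoord`. -/
def cayleyCoord (u₀ u : K →L[ℂ] K) : SkewOp K := skewPart (cayley (u * star u₀))

variable {u₀ u : K →L[ℂ] K}

theorem coe_cayleyCoord (h₀ : u₀ ∈ unitary (K →L[ℂ] K)) (hu : u ∈ cayleyChartDomain u₀) :
    (cayleyCoord u₀ u : K →L[ℂ] K) = cayley (u * star u₀) := by
  rw [cayleyCoord, skewPart_of_mem_skewAdjoint
    (cayley_mem_skewAdjoint (mul_mem hu.2 (Unitary.star_mem h₀)) hu.1)]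

theorem cayley_mul_star_cancel (h₀ : u₀ ∈ unitary (K →L[ℂ] K)) (x : K →L[ℂ] K) :
    cayley x * u₀ * star u₀ = cayley x := by
  rw [mul_assoc, Unitary.mul_star_self_of_mem h₀, mul_one]

theorem cayley_mul_mem_cayleyChartDomain (h₀ : u₀ ∈ unitary (K →L[ℂ] K)) (S : SkewOp K) :
    cayley (S : K →L[ℂ] K) * u₀ ∈ cayleyChartDomain u₀ := by
  refine ⟨?_, mul_mem (cayley_mem_unitary S.2) h₀⟩
  rw [Set.mem_ofPred_eq, cayley_mul_star_cancel h₀]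
  exact isUnit_one_add_cayley isUnit_two (isUnit_one_add_of_mem_skewAdjoint S.2)

theorem cayleyCoord_cayley_mul (h₀ : u₀ ∈ unitary (K →L[ℂ] K)) (S : SkewOp K) :
    cayleyCoord u₀ (cayley (S : K →L[ℂ] K) * u₀) = S := by
  apply Subtype.ext
  rw [coe_cayleyCoord h₀ (cayley_mul_mem_cayleyChartDomain h₀ S), cayley_mul_star_cancel h₀,
    cayley_cayley isUnit_two (isUnit_one_add_of_mem_skewAdjoint S.2)]

theorem cayley_cayleyCoord_mul (h₀ : u₀ ∈ unitary (K →L[ℂ] K)) (hu : u ∈ cayleyChartDomain u₀) :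
    cayley (cayleyCoord u₀ u : K →L[ℂ] K) * u₀ = u := by
  rw [coe_cayleyCoord h₀ hu, cayley_cayley isUnit_two hu.1, mul_assoc,
    Unitary.star_mul_self_of_mem h₀, mul_one]

theorem cayleyCoord_image (h₀ : u₀ ∈ unitary (K →L[ℂ] K)) :
    cayleyCoord u₀ '' cayleyChartDomain u₀ = Set.univ :=
  Set.eq_univ_of_forall fun S =>
    ⟨_, cayley_mul_mem_cayleyChartDomain h₀ S, cayleyCoord_cayley_mul h₀ S⟩

theorem contDiffOn_cayleyCoord : ContDiffOn ℝ ∞ (cayleyCoord u₀) (cayleyChartDomain u₀) := by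
  have hmul : ContDiffOn ℝ ∞ (fun u : K →L[ℂ] K => u * star u₀) (cayleyChartDomain u₀) :=
    contDiffOn_id.mul contDiffOn_const
  exact skewPart.contDiff.comp_contDiffOn (contDiffOn_cayley hmul fun _ hu => hu.1)

theorem contDiff_cayley_mul (u₀ : K →L[ℂ] K) :
    ContDiff ℝ ∞ fun S : SkewOp K => cayley (S : K →L[ℂ] K) * u₀ := by
  have hcoe : ContDiff ℝ ∞ fun S : SkewOp K => (S : K →L[ℂ] K) :=
    (skewAdjoint.submodule ℝ (K →L[ℂ] K)).subtypeL.contDiff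
  rw [← contDiffOn_univ]
  exact (contDiffOn_cayley hcoe.contDiffOn
    fun S _ => isUnit_one_add_of_mem_skewAdjoint S.2).mul contDiffOn_const

/-- The chart `u ↦ (1 - u u₀*) (1 + u u₀*)⁻¹` of the unitary group centred at `u₀`. -/
def cayleyChart (u₀ : K →L[ℂ] K) (h₀ : u₀ ∈ unitary (K →L[ℂ] K)) : UnitaryChart K where
  dom := cayleyChartDomain u₀
  toFun := cayleyCoord u₀
  isOpen_dom := ⟨_, Units.isOpen.preimage
    (continuous_const.add (continuous_id.mul continuous_const)), rfl⟩
  isOpen_image := by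
    rw [cayleyCoord_image h₀]
    exact isOpen_univ
  smooth := contDiffOn_cayleyCoord
  smooth_inv := ⟨_, (contDiff_cayley_mul u₀).contDiffOn, fun _ hu => cayley_cayleyCoord_mul h₀ hu⟩

theorem mem_cayleyChart_dom (h₀ : u₀ ∈ unitary (K →L[ℂ] K)) : u₀ ∈ (cayleyChart u₀ h₀).dom := by
  refine ⟨?_, h₀⟩
  rw [Set.mem_ofPred_eq, Unitary.mul_star_self_of_mem h₀, one_add_one_eq_two]
  exact isUnit_two (A := K →L[ℂ] K)

end CayleyChart

namespace UnitaryChart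

variable {K : Type*} [NormedAddCommGroup K] [InnerProductSpace ℂ K] [CompleteSpace K]

/-- A smooth inverse of a chart of the unitary group. -/
def inv (α : UnitaryChart K) : SkewOp K → (K →L[ℂ] K) := α.smooth_inv.choose

variable (α : UnitaryChart K)

theorem contDiffOn_inv : ContDiffOn ℝ ∞ α.inv (α.toFun '' α.dom) := α.smooth_inv.choose_spec.1

theorem inv_toFun {u : K →L[ℂ] K} (hu : u ∈ α.dom) : α.inv (α.toFun u) = u :=
  α.smooth_inv.choose_spec.2 u hu

theorem inv_mem {S : SkewOp K} (hS : S ∈ α.toFun '' α.dom) : α.inv S ∈ α.dom := by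
  obtain ⟨u, hu, rfl⟩ := hS
  rwa [α.inv_toFun hu]

theorem toFun_inv {S : SkewOp K} (hS : S ∈ α.toFun '' α.dom) : α.toFun (α.inv S) = S := by
  obtain ⟨u, hu, rfl⟩ := hS
  rw [α.inv_toFun hu]

theorem dom_subset_unitary : α.dom ⊆ unitary (K →L[ℂ] K) := by
  obtain ⟨O, -, h⟩ := α.isOpen_dom
  rw [h]
  exact Set.inter_subset_right

end UnitaryChart

/-! ### Partial isometries between points of the restricted Grassmannian -/

section Corner

variable {H : Type*} [NormedAddCommGroup H] [InnerProductSpace ℂ H]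
variable (Hp : Submodule ℂ H) [CompleteSpace Hp]

/-- Extension by zero of an operator on a closed subspace. -/
def extendOp : (Hp →L[ℂ] Hp) →L[ℂ] (H →L[ℂ] H) :=
  ContinuousLinearMap.compL ℂ H Hp H Hp.subtypeL ∘L
    (ContinuousLinearMap.compL ℂ H Hp Hp).flip Hp.orthogonalProjectionOnto

/-- Compression of an operator to a closed subspace. -/
def compressOp : (H →L[ℂ] H) →L[ℂ] (Hp →L[ℂ] Hp) :=
  ContinuousLinearMap.compL ℂ Hp H Hp Hp.orthogonalProjectionOnto ∘L
    (ContinuousLinearMap.compL ℂ Hp H H).flip Hp.subtypeL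

variable {Hp}

theorem extendOp_apply (τ : Hp →L[ℂ] Hp) :
    extendOp Hp τ = Hp.subtypeL ∘L τ ∘L Hp.orthogonalProjectionOnto := rfl

theorem compressOp_apply (x : H →L[ℂ] H) :
    compressOp Hp x = Hp.orthogonalProjectionOnto ∘L x ∘L Hp.subtypeL := rfl

theorem extendOp_one : extendOp Hp 1 = Hp.starProjection := rfl

theorem extendOp_mul (σ τ : Hp →L[ℂ] Hp) :
    extendOp Hp (σ * τ) = extendOp Hp σ * extendOp Hp τ := by
  ext x
  simp [extendOp_apply]

theorem star_extendOp [CompleteSpace H] (τ : Hp →L[ℂ] Hp) :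
    star (extendOp Hp τ) = extendOp Hp (star τ) := by
  simp only [ContinuousLinearMap.star_eq_adjoint, extendOp_apply, ContinuousLinearMap.adjoint_comp,
    Submodule.adjoint_subtypeL, Submodule.adjoint_orthogonalProjectionOnto,
    ContinuousLinearMap.comp_assoc]

theorem compressOp_extendOp (τ : Hp →L[ℂ] Hp) : compressOp Hp (extendOp Hp τ) = τ := by
  ext x
  simp [extendOp_apply, compressOp_apply]

theorem extendOp_compressOp (x : H →L[ℂ] H) :
    extendOp Hp (compressOp Hp x) = Hp.starProjection * x * Hp.starProjection := rfl

end Corner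

namespace LocalSection

variable {H : Type*} [NormedAddCommGroup H] [InnerProductSpace ℂ H] [CompleteSpace H]
variable {Hp : Submodule ℂ H} [CompleteSpace Hp]

/-- The values of a local section as bounded operators. -/
def op (β : LocalSection Hp) (V : ResGr Hp) : H →L[ℂ] H := ResOp.toCLM Hp (β.toFun V)

variable {β γ δ : LocalSection Hp} {U V W : ResGr Hp}

theorem op_mem_unitary (hV : V ∈ β.dom) : β.op V ∈ unitary (H →L[ℂ] H) := β.mem_resUnitary V hV

theorem star_op_mul_op (hV : V ∈ β.dom) : star (β.op V) * β.op V = 1 :=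
  Unitary.star_mul_self_of_mem (op_mem_unitary hV)

theorem op_mul_starProjection_mul_star_op (hV : V ∈ β.dom) :
    β.op V * Hp.starProjection * star (β.op V) = V := by
  have hcomm := (map_eq_iff_mul_starProjection_eq (op_mem_unitary hV) Hp _).1 (β.map_eq V hV)
  rw [hcomm, ResGr.starProjection_space, mul_assoc,
    Unitary.mul_star_self_of_mem (op_mem_unitary hV), mul_one]

variable (β) in
theorem isOpen_ofGraph_preimage_dom (W : ResGr Hp) : IsOpen (ResGr.ofGraph W ⁻¹' β.dom) := by
  have hdom : ResGr.ofGraph W ⁻¹' β.dom = ResGr.ofGraph W ⁻¹' ResGr.chartDomain β.base ∩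
      (fun T => ResGr.chart β.base (ResGr.ofGraph W T)) ⁻¹' (ResGr.chart β.base '' β.dom) := by
    ext T
    refine ⟨fun hT => ⟨β.dom_subset hT, _, hT, rfl⟩, fun ⟨hT, V, hV, hVT⟩ => ?_⟩
    rwa [Set.mem_preimage, ← ResGr.chart_injOn _ (β.dom_subset hV) hT hVT]
  rw [hdom]
  exact (ResGr.contDiffOn_chart_ofGraph W β.base).continuousOn.isOpen_inter_preimage
    (ResGr.isOpen_ofGraph_preimage_chartDomain W β.base) β.isOpen_dom

variable (β) in
theorem contDiffOn_op_ofGraph (W : ResGr Hp) :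
    ContDiffOn ℝ ∞ (fun T => β.op (ResGr.ofGraph W T)) (ResGr.ofGraph W ⁻¹' β.dom) := by
  obtain ⟨g, hg, hgβ⟩ := β.smooth
  have hchart : ContDiffOn ℝ ∞ (fun T => ResGr.chart β.base (ResGr.ofGraph W T))
      (ResGr.ofGraph W ⁻¹' β.dom) :=
    (ResGr.contDiffOn_chart_ofGraph W β.base).mono fun _ hT => β.dom_subset hT
  refine (contDiffOn_complexCLM_apply (ResOp.toCLML Hp)
    (hg.comp hchart fun T hT => ⟨_, hT, rfl⟩)).congr fun T hT => ?_
  rw [Function.comp_apply, hgβ _ hT]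
  rfl

variable (β γ) in
/-- The operator `σ_γ(V) τ σ_β(U)⁻¹`. If `τ` is unitary, it is a partial isometry with source `U`
and target `V`. -/
def glue (U V : ResGr Hp) (τ : Hp →L[ℂ] Hp) : H →L[ℂ] H :=
  γ.op V * extendOp Hp τ * star (β.op U)

theorem star_glue (U V : ResGr Hp) (τ : Hp →L[ℂ] Hp) :
    star (glue β γ U V τ) = glue γ β V U (star τ) := by
  simp only [glue, star_mul, star_star, star_extendOp, mul_assoc]

theorem glue_mul_glue (hV : V ∈ γ.dom) (σ τ : Hp →L[ℂ] Hp) :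
    glue γ δ V W σ * glue β γ U V τ = glue β δ U W (σ * τ) := by
  calc glue γ δ V W σ * glue β γ U V τ
      = δ.op W * extendOp Hp σ * (star (γ.op V) * γ.op V) * extendOp Hp τ * star (β.op U) := by
        simp only [glue, mul_assoc]
    _ = glue β δ U W (σ * τ) := by
        rw [star_op_mul_op hV, mul_one, mul_assoc (δ.op W), ← extendOp_mul, glue]

theorem glue_self_one (hV : V ∈ β.dom) : glue β β V V 1 = V := by
  rw [glue, extendOp_one, op_mul_starProjection_mul_star_op hV]

theorem compressOp_glue (hU : U ∈ β.dom) (hV : V ∈ γ.dom) (τ : Hp →L[ℂ] Hp) :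
    compressOp Hp (star (γ.op V) * glue β γ U V τ * β.op U) = τ := by
  calc compressOp Hp (star (γ.op V) * glue β γ U V τ * β.op U)
      = compressOp Hp ((star (γ.op V) * γ.op V) * extendOp Hp τ * (star (β.op U) * β.op U)) := by
        simp only [glue, mul_assoc]
    _ = τ := by rw [star_op_mul_op hU, star_op_mul_op hV, one_mul, mul_one, compressOp_extendOp]

theorem glue_injective (hU : U ∈ β.dom) (hV : V ∈ γ.dom) :
    Function.Injective (glue β γ U V) := fun σ τ h => by
  rw [← compressOp_glue hU hV σ, h, compressOp_glue hU hV]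

theorem star_glue_mul_glue (hU : U ∈ β.dom) (hV : V ∈ γ.dom) {τ : Hp →L[ℂ] Hp}
    (hτ : τ ∈ unitary (Hp →L[ℂ] Hp)) : star (glue β γ U V τ) * glue β γ U V τ = U := by
  rw [star_glue, glue_mul_glue hV, Unitary.star_mul_self_of_mem hτ, glue_self_one hU]

theorem glue_mul_star_glue (hU : U ∈ β.dom) (hV : V ∈ γ.dom) {τ : Hp →L[ℂ] Hp}
    (hτ : τ ∈ unitary (Hp →L[ℂ] Hp)) : glue β γ U V τ * star (glue β γ U V τ) = V := by
  rw [star_glue, glue_mul_glue hU, Unitary.mul_star_self_of_mem hτ, glue_self_one hV]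

end LocalSection

section URes

open LocalSection

variable {H : Type*} [NormedAddCommGroup H] [InnerProductSpace ℂ H] [CompleteSpace H]

theorem IsPartialIsometry.mul_star_mul {u : H →L[ℂ] H} (hu : IsPartialIsometry u) :
    u * star u * u = u := by
  have hidem : star u * u * (star u * u) = star u * u := hu.isIdempotentElem.eq
  rw [← sub_eq_zero, ← CStarRing.star_mul_self_eq_zero_iff]
  calc star (u * star u * u - u) * (u * star u * u - u)
      = star u * u * (star u * u) * (star u * u) - star u * u * (star u * u) -
          (star u * u * (star u * u) - star u * u) := by
        simp only [star_sub, star_mul, star_star]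
        noncomm_ring
    _ = 0 := by rw [hidem, hidem, sub_self]

namespace URes

variable {Hp : Submodule ℂ H} [CompleteSpace Hp] {β γ : LocalSection Hp} {u : URes Hp}

theorem target_mul_mul_source (u : URes Hp) :
    (target u : H →L[ℂ] H) * u.1 * (source u : H →L[ℂ] H) = u := by
  have hu : u.1 * star u.1 * u.1 = u.1 := u.2.1.mul_star_mul
  change u.1 * star u.1 * u.1 * (star u.1 * u.1) = u.1
  rw [hu, ← mul_assoc, hu]

theorem glue_transport (hs : source u ∈ β.dom) (ht : target u ∈ γ.dom) :
    glue β γ (source u) (target u) (transport β γ u) = u := by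
  calc glue β γ (source u) (target u) (transport β γ u)
      = γ.op (target u) *
          extendOp Hp (compressOp Hp (star (γ.op (target u)) * u.1 * β.op (source u))) *
          star (β.op (source u)) := rfl
    _ = γ.op (target u) * Hp.starProjection * star (γ.op (target u)) * u.1 *
          (β.op (source u) * Hp.starProjection * star (β.op (source u))) := by
        simp only [extendOp_compressOp, mul_assoc]
    _ = u := by
        rw [op_mul_starProjection_mul_star_op hs, op_mul_starProjection_mul_star_op ht,
          target_mul_mul_source]

theorem transport_mem_unitary (hs : source u ∈ β.dom) (ht : target u ∈ γ.dom) :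
    transport β γ u ∈ unitary (Hp →L[ℂ] Hp) := by
  have hu := glue_transport hs ht
  refine Unitary.mem_iff.2 ⟨glue_injective hs hs ?_, glue_injective ht ht ?_⟩
  · rw [← glue_mul_glue ht, ← star_glue, hu, glue_self_one hs]
    rfl
  · rw [← glue_mul_glue hs, ← star_glue, hu, glue_self_one ht]
    rfl

theorem exists_eq_glue {U V : ResGr Hp} {τ : Hp →L[ℂ] Hp} (hU : U ∈ β.dom) (hV : V ∈ γ.dom)
    (hτ : τ ∈ unitary (Hp →L[ℂ] Hp)) :
    ∃ u : URes Hp, source u = U ∧ target u = V ∧ u = glue β γ U V τ := by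
  have hsource := star_glue_mul_glue hU hV hτ
  have htarget := glue_mul_star_glue hU hV hτ
  refine ⟨⟨glue β γ U V τ, ?_, ?_, ?_⟩, Subtype.ext hsource, Subtype.ext htarget, rfl⟩
  · rw [IsPartialIsometry, hsource]
    exact ResGr.isStarProjection U
  · rw [hsource]
    exact U.2
  · rw [htarget]
    exact V.2

end URes

end URes

/-! ### The atlas of the groupoid -/

namespace URes

variable {H : Type*} [NormedAddCommGroup H] [InnerProductSpace ℂ H] [CompleteSpace H]
variable {Hp : Submodule ℂ H} [CompleteSpace Hp] {i j : ChartIndex Hp} {u : URes Hp}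

/-- The element of the groupoid with coordinates `x` in the chart `i`, as a bounded operator. -/
def ofCoord (i : ChartIndex Hp) (x : Model i) : H →L[ℂ] H :=
  i.β.glue i.γ (ResGr.ofGraph i.β.base x.2.1) (ResGr.ofGraph i.γ.base x.1) (i.α.inv x.2.2)

/-- The image of the chart `i`. -/
def image (i : ChartIndex Hp) : Set (Model i) :=
  (ResGr.ofGraph i.γ.base ⁻¹' i.γ.dom) ×ˢ (ResGr.ofGraph i.β.base ⁻¹' i.β.dom) ×ˢ
    (i.α.toFun '' i.α.dom)

/-- The common domain of the charts `i` and `j` in the coordinates of `i`, up to the condition that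
the transport of `j` is in the domain of the chart of the unitary group. -/
def preOverlap (i j : ChartIndex Hp) : Set (Model i) :=
  image i ∩ (ResGr.ofGraph i.γ.base ⁻¹' j.γ.dom) ×ˢ (ResGr.ofGraph i.β.base ⁻¹' j.β.dom) ×ˢ
    Set.univ

theorem isOpen_preOverlap (i j : ChartIndex Hp) : IsOpen (preOverlap i j) :=
  ((i.γ.isOpen_ofGraph_preimage_dom _).prod
    ((i.β.isOpen_ofGraph_preimage_dom _).prod i.α.isOpen_image)).inter
  ((j.γ.isOpen_ofGraph_preimage_dom _).prod
    ((j.β.isOpen_ofGraph_preimage_dom _).prod isOpen_univ))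

theorem ofGraph_chart_target (hu : u ∈ chartDomain i) :
    ResGr.ofGraph i.γ.base (chart i u).1 = target u :=
  ResGr.ofGraph_chart (i.γ.dom_subset hu.2.1)

theorem ofGraph_chart_source (hu : u ∈ chartDomain i) :
    ResGr.ofGraph i.β.base (chart i u).2.1 = source u :=
  ResGr.ofGraph_chart (i.β.dom_subset hu.1)

theorem chart_mem_image (hu : u ∈ chartDomain i) : chart i u ∈ image i := by
  refine ⟨?_, ?_, _, hu.2.2, rfl⟩
  · rw [Set.mem_preimage, ofGraph_chart_target hu]
    exact hu.2.1
  · rw [Set.mem_preimage, ofGraph_chart_source hu]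
    exact hu.1

theorem ofCoord_chart (hu : u ∈ chartDomain i) : ofCoord i (chart i u) = u := by
  rw [ofCoord, ofGraph_chart_target hu, ofGraph_chart_source hu, chart, i.α.inv_toFun hu.2.2,
    glue_transport hu.1 hu.2.1]

theorem injOn_chart (i : ChartIndex Hp) : Set.InjOn (chart i) (chartDomain i) :=
  fun u hu v hv h => Subtype.ext (by rw [← ofCoord_chart hu, h, ofCoord_chart hv])

theorem exists_chart_eq {x : Model i} (hx : x ∈ image i) : ∃ u ∈ chartDomain i, chart i u = x := by
  obtain ⟨T, S, s⟩ := x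
  obtain ⟨hT, hS, hs⟩ := hx
  obtain ⟨u, hsource, htarget, hu⟩ := exists_eq_glue (Hp := Hp) hS hT
    (i.α.dom_subset_unitary (i.α.inv_mem hs))
  have htransport : transport i.β i.γ u = i.α.inv s := by
    rw [← LocalSection.compressOp_glue hS hT (i.α.inv s), ← hu, ← hsource, ← htarget]
    rfl
  refine ⟨u, ⟨?_, ?_, ?_⟩, ?_⟩
  · rwa [hsource]
  · rwa [htarget]
  · rw [htransport]
    exact i.α.inv_mem hs
  · rw [chart, hsource, htarget, htransport, ResGr.chart_ofGraph, ResGr.chart_ofGraph,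
      i.α.toFun_inv hs]

theorem contDiffOn_ofCoord (i : ChartIndex Hp) : ContDiffOn ℝ ∞ (ofCoord i) (image i) := by
  have htarget : ContDiffOn ℝ ∞
      (fun x : Model i => i.γ.op (ResGr.ofGraph i.γ.base x.1)) (image i) :=
    (i.γ.contDiffOn_op_ofGraph _).comp contDiff_fst.contDiffOn fun x hx => hx.1
  have hsource : ContDiffOn ℝ ∞
      (fun x : Model i => i.β.op (ResGr.ofGraph i.β.base x.2.1)) (image i) :=
    (i.β.contDiffOn_op_ofGraph _).comp (contDiff_fst.comp contDiff_snd).contDiffOn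
      fun x hx => hx.2.1
  have hsource_star : ContDiffOn ℝ ∞
      (fun x : Model i => star (i.β.op (ResGr.ofGraph i.β.base x.2.1))) (image i) :=
    (starL' ℝ : (H →L[ℂ] H) ≃L[ℝ] (H →L[ℂ] H)).contDiff.comp_contDiffOn hsource
  have htransport : ContDiffOn ℝ ∞ (fun x : Model i => extendOp Hp (i.α.inv x.2.2)) (image i) :=
    contDiffOn_complexCLM_apply (extendOp Hp)
      (i.α.contDiffOn_inv.comp (contDiff_snd.comp contDiff_snd).contDiffOn fun x hx => hx.2.2)
  exact (htarget.mul htransport).mul hsource_star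

/-- The transport of the chart `j` in the coordinates of the chart `i`. -/
def otherTransport (i j : ChartIndex Hp) (x : Model i) : Hp →L[ℂ] Hp :=
  compressOp Hp (star (j.γ.op (ResGr.ofGraph i.γ.base x.1)) * ofCoord i x *
    j.β.op (ResGr.ofGraph i.β.base x.2.1))

theorem otherTransport_chart (hu : u ∈ chartDomain i) :
    otherTransport i j (chart i u) = transport j.β j.γ u := by
  rw [otherTransport, ofCoord_chart hu, ofGraph_chart_target hu, ofGraph_chart_source hu]
  rfl

theorem contDiffOn_otherTransport (i j : ChartIndex Hp) :
    ContDiffOn ℝ ∞ (otherTransport i j) (preOverlap i j) := by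
  have htarget : ContDiffOn ℝ ∞
      (fun x : Model i => j.γ.op (ResGr.ofGraph i.γ.base x.1)) (preOverlap i j) :=
    (j.γ.contDiffOn_op_ofGraph _).comp contDiff_fst.contDiffOn fun x hx => hx.2.1
  have hsource : ContDiffOn ℝ ∞
      (fun x : Model i => j.β.op (ResGr.ofGraph i.β.base x.2.1)) (preOverlap i j) :=
    (j.β.contDiffOn_op_ofGraph _).comp (contDiff_fst.comp contDiff_snd).contDiffOn
      fun x hx => hx.2.2.1
  have htarget_star : ContDiffOn ℝ ∞
      (fun x : Model i => star (j.γ.op (ResGr.ofGraph i.γ.base x.1))) (preOverlap i j) :=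
    (starL' ℝ : (H →L[ℂ] H) ≃L[ℝ] (H →L[ℂ] H)).contDiff.comp_contDiffOn htarget
  have hcoord : ContDiffOn ℝ ∞ (ofCoord i) (preOverlap i j) :=
    (contDiffOn_ofCoord i).mono Set.inter_subset_left
  have hmul : ContDiffOn ℝ ∞ (fun x : Model i =>
      star (j.γ.op (ResGr.ofGraph i.γ.base x.1)) * ofCoord i x *
        j.β.op (ResGr.ofGraph i.β.base x.2.1)) (preOverlap i j) :=
    (htarget_star.mul hcoord).mul hsource
  exact contDiffOn_complexCLM_apply (Y := Hp →L[ℂ] Hp) (compressOp Hp) hmul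

theorem chart_mem_preOverlap (hi : u ∈ chartDomain i) :
    chart i u ∈ preOverlap i j ↔ source u ∈ j.β.dom ∧ target u ∈ j.γ.dom := by
  simp only [preOverlap, Set.mem_inter_iff, chart_mem_image hi, Set.mem_prod, Set.mem_preimage,
    ofGraph_chart_target hi, ofGraph_chart_source hi, Set.mem_univ, true_and,
    and_comm]

theorem chart_image_inter (i j : ChartIndex Hp) :
    chart i '' (chartDomain i ∩ chartDomain j) =
      preOverlap i j ∩ otherTransport i j ⁻¹' j.α.dom := by
  ext x
  constructor
  · rintro ⟨u, ⟨hi, hj⟩, rfl⟩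
    refine ⟨(chart_mem_preOverlap hi).2 ⟨hj.1, hj.2.1⟩, ?_⟩
    rw [Set.mem_preimage, otherTransport_chart hi]
    exact hj.2.2
  · rintro ⟨hx, hτ⟩
    obtain ⟨u, hi, rfl⟩ := exists_chart_eq hx.1
    rw [Set.mem_preimage, otherTransport_chart hi] at hτ
    have hdom := (chart_mem_preOverlap hi).1 hx
    exact ⟨u, ⟨hi, hdom.1, hdom.2, hτ⟩, rfl⟩

theorem otherTransport_mem_unitary {x : Model i} (hx : x ∈ preOverlap i j) :
    otherTransport i j x ∈ unitary (Hp →L[ℂ] Hp) := by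
  obtain ⟨u, hi, rfl⟩ := exists_chart_eq hx.1
  have hdom := (chart_mem_preOverlap hi).1 hx
  rw [otherTransport_chart hi]
  exact transport_mem_unitary hdom.1 hdom.2

theorem isOpen_chart_image_inter (i j : ChartIndex Hp) :
    IsOpen (chart i '' (chartDomain i ∩ chartDomain j)) := by
  obtain ⟨O, hO, hdom⟩ := j.α.isOpen_dom
  have himage : chart i '' (chartDomain i ∩ chartDomain j) =
      preOverlap i j ∩ otherTransport i j ⁻¹' O := by
    rw [chart_image_inter, hdom]
    ext x
    exact and_congr_right fun hx => and_iff_left (otherTransport_mem_unitary hx)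
  rw [himage]
  exact (contDiffOn_otherTransport i j).continuousOn.isOpen_inter_preimage
    (isOpen_preOverlap i j) hO

theorem exists_contDiffOn_transition (i j : ChartIndex Hp) : ∃ g : Model i → Model j,
    ContDiffOn ℝ ∞ g (chart i '' (chartDomain i ∩ chartDomain j)) ∧
      ∀ u ∈ chartDomain i ∩ chartDomain j, g (chart i u) = chart j u := by
  refine ⟨fun x => (ResGr.chart j.γ.base (ResGr.ofGraph i.γ.base x.1),
    ResGr.chart j.β.base (ResGr.ofGraph i.β.base x.2.1), j.α.toFun (otherTransport i j x)), ?_, ?_⟩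
  · rw [chart_image_inter]
    refine ContDiffOn.prodMk ?_ (ContDiffOn.prodMk ?_ ?_)
    · exact (ResGr.contDiffOn_chart_ofGraph _ _).comp contDiff_fst.contDiffOn
        fun x hx => j.γ.dom_subset hx.1.2.1
    · exact (ResGr.contDiffOn_chart_ofGraph _ _).comp (contDiff_fst.comp contDiff_snd).contDiffOn
        fun x hx => j.β.dom_subset hx.1.2.2.1
    · exact j.α.smooth.comp ((contDiffOn_otherTransport i j).mono Set.inter_subset_left)
        fun x hx => hx.2
  · rintro u ⟨hi, -⟩
    simp only [otherTransport_chart hi, ofGraph_chart_target hi, ofGraph_chart_source hi]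
    rfl

theorem exists_mem_chartDomain [TopologicalSpace.SeparableSpace H]
    (hp : ¬ FiniteDimensional ℂ Hp) (hm : ¬ FiniteDimensional ℂ Hpᗮ) (u : URes Hp) :
    ∃ i, u ∈ chartDomain i := by
  obtain ⟨β, hβ⟩ := ResGr.exists_localSection hp hm (source u)
  obtain ⟨γ, hγ⟩ := ResGr.exists_localSection hp hm (target u)
  have hunitary := transport_mem_unitary hβ hγ
  exact ⟨⟨cayleyChart _ hunitary, β, γ⟩, hβ, hγ, mem_cayleyChart_dom hunitary⟩

theorem t2Space_atlasTopology_chart [TopologicalSpace.SeparableSpace H]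
    (hp : ¬ FiniteDimensional ℂ Hp) (hm : ¬ FiniteDimensional ℂ Hpᗮ) :
    @T2Space (URes Hp) (atlasTopology chartDomain chart) := by
  refine t2Space_atlasTopology (exists_mem_chartDomain hp hm) (f := fun u : URes Hp => u.1)
    Subtype.val_injective fun i => ⟨?_, ofCoord i, ?_, fun u hu => ofCoord_chart hu⟩
  · rw [← Set.inter_self (chartDomain i)]
    exact isOpen_chart_image_inter i i
  · exact (contDiffOn_ofCoord i).continuousOn.mono
      (Set.image_subset_iff.2 fun u hu => chart_mem_image hu)

theorem isBanachManifoldAtlas [TopologicalSpace.SeparableSpace H]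
    (hp : ¬ FiniteDimensional ℂ Hp) (hm : ¬ FiniteDimensional ℂ Hpᗮ) :
    IsBanachManifoldAtlas (chartDomain (Hp := Hp)) chart :=
  ⟨fun _ => inferInstance, exists_mem_chartDomain hp hm, injOn_chart, isOpen_chart_image_inter,
    exists_contDiffOn_transition, t2Space_atlasTopology_chart hp hm⟩

end URes

section RealRestrict

variable {X Y : Type*} [NormedAddCommGroup X] [NormedSpace ℂ X] [NormedAddCommGroup Y]
  [NormedSpace ℂ Y]

/-- A complex isomorphism as a real isomorphism; `ContinuousLinearEquiv.restrictScalars` is only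
available for automorphisms. -/
def realRestrict (e : X ≃L[ℂ] Y) : X ≃L[ℝ] Y :=
  { e.toLinearEquiv.restrictScalars ℝ with
    continuous_toFun := e.continuous
    continuous_invFun := e.symm.continuous }

end RealRestrict

theorem URes.nonempty_model_equiv {H : Type*} [NormedAddCommGroup H] [InnerProductSpace ℂ H]
    [CompleteSpace H] [TopologicalSpace.SeparableSpace H] {Hp : Submodule ℂ H} [CompleteSpace Hp]
    (hp : ¬ FiniteDimensional ℂ Hp) (hm : ¬ FiniteDimensional ℂ Hpᗮ) (i : ChartIndex Hp) :
    Nonempty (Model i ≃L[ℝ] HilbertSchmidt Hp Hpᗮ × HilbertSchmidt Hp Hpᗮ × SkewOp Hp) := by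
  obtain ⟨e⟩ := ResGr.nonempty_model_equiv hp hm i.γ.base
  obtain ⟨f⟩ := ResGr.nonempty_model_equiv hp hm i.β.base
  exact ⟨(realRestrict e).prodCongr ((realRestrict f).prodCongr (.refl ℝ _))⟩

end

theorem mainTheorem3 {H : Type*} [NormedAddCommGroup H] [InnerProductSpace ℂ H] [CompleteSpace H]
    [TopologicalSpace.SeparableSpace H] (Hp : Submodule ℂ H) [CompleteSpace Hp]
    (hp : ¬ FiniteDimensional ℂ Hp) (hm : ¬ FiniteDimensional ℂ Hpᗮ) :
    -- transitive
    Function.Surjective (fun u : URes Hp => (URes.source u, URes.target u)) ∧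
    -- the base is a Banach manifold, with model spaces isomorphic to `L²(H₊, H₋)`
    ((∀ W : ResGr Hp, ∀ V ∈ ResGr.chartDomain W, IsHilbertSchmidt (ResGr.chartOp W V)) ∧
      IsBanachManifoldAtlas (ResGr.chartDomain (Hp := Hp)) ResGr.chart ∧
      ∀ W : ResGr Hp, Nonempty
        (HilbertSchmidt (ResGr.space W) (ResGr.space W)ᗮ ≃L[ℂ] HilbertSchmidt Hp Hpᗮ)) ∧
    -- the total space is a Banach manifold, with model spaces isomorphic to
    -- `L²(H₊, H₋) × L²(H₊, H₋) × 𝔲₊`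
    (IsBanachManifoldAtlas (URes.chartDomain (Hp := Hp)) URes.chart ∧
      ∀ i : URes.ChartIndex Hp, Nonempty
        (URes.Model i ≃L[ℝ] HilbertSchmidt Hp Hpᗮ × HilbertSchmidt Hp Hpᗮ × SkewOp Hp)) :=
  ⟨URes.source_target_surjective hp,
    ⟨fun W V _ => ResGr.isHilbertSchmidt_chartOp W V, ResGr.isBanachManifoldAtlas,
      ResGr.nonempty_model_equiv hp hm⟩,
    URes.isBanachManifoldAtlas hp hm, URes.nonempty_model_equiv hp hm⟩
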